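/- **Decorated graphs.** For a free abelian group $H$ of finite rank let $\mathbb{Q}[\exp(H)]$ be its group algebra, with basis $\exp(\mu)$, $\mu\in H$, and $F(H)=S^{-1}\mathbb{Q}[\exp(H)]$, where $S$ is the set of products of non-zero elements $P(\exp(h))$, $P\in\mathbb{Q}[t]$, $h\in H$. Let $\mathcal{B}^{\rm rat}_s$ be the quotient of $\bigoplus_\Gamma F(H^1(\Gamma,\mathbb{Z}))$, over finite trivalent graphs $\Gamma$ with oriented vertices (circle components allowed), by: isomorphism of graphs; change of sign when the orientation of one vertex is reversed; and the relation $x_I=x_H-x_X$ for the three resolutions $I,H,X$ of a four-valent vertex (whose $H^1$ are canonically identified). Series of diagrams are considered degree by degree in the loop degree. **The operators.** Let $r\ge 1$. Any $x\in F(H)$ is a fraction $a/\psi_r(s)$ with $a\in\mathbb{Q}[\exp(H)]$, $s\in S$ and $\psi_r(\exp(\mu))=\exp(r\mu)$. Put $\mathrm{lift}_r(x)=u_r(a)/s$, where $u_r(\exp(r\mu))=\exp(\mu)$ and $u_r(\exp(\mu))=0$ for $\mu\notin rH$. On $\mathcal{B}^{\rm rat}_s$, $\mathrm{lift}_r$ sends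 the graph $\Gamma$ decorated by $x$ to $r$ times $\Gamma$ decorated by $\mathrm{lift}_r(x)$ (the normalization for connected diagrams), and $\Pi_r$ multiplies a diagram with underlying graph $\Gamma$ by $r^{-\chi(\Gamma)}$, $\chi$ being the Euler characteristic. **The series.** Let $p>0$ and $q\neq 0$ be coprime integers. Consider series of finite unoriented graphs with vertices coloured by $*,a,b,c$; $\exp$ and $\log$ are taken for disjoint union, and $X\,{}^{A}\!\!\times^{B} Y=\log(\exp X\cdot\exp Y)$, where $\cdot$ adds in all ways finitely many edges between $A$-coloured vertices of the first factor and $B$-coloured vertices of the second. For a colour $x$, $x^{t}$ divides a graph by $t^{M}$, $M$ being the sum of the valences of its $x$-coloured vertices. Put $X^{-1}_{pq}=a^pb^q(\bullet_a\,{}^{a}\!\!\times^{b}\bullet_b)$, $X^0=\bullet_*$, $X^n_{pq}=(*^{pq}X^n)|_{*\to c}$ for $n\ge 0$, and $$X^{n+1}=(X^{n-1}_{pq}-X^n_{pq})\,{}^{\{a,b,c\}}\!\!\times^{*}X^n-(X^{n-1}_{pq}-X^n_{pq}),\qquad X_{p,q}=\lim_n\,(X^{-1}_{pq}-X^n_{pq}).$$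 Let $Dg(t)=t\,g'(t)$ on $\mathbb{Q}(t)$, $h_n(t)=\frac{t^n+1}{t^n-1}$, and let $n_v=p,q,pq$ for a vertex $v$ of colour $a,b,c$. For a tree $T$ with at least one edge and vertices coloured by $a,b,c$, let $T^{\rm rat}\in\mathcal{B}^{\rm rat}_s$ be obtained by replacing each vertex $v$ by a circle to which the edges at $v$ are attached (in any cyclic order), with decoration $$\prod_v \kappa_{c(v)}\,(D^{k_v-1}h_{n_v})(\exp(h_v)),$$ where $k_v$ is the valence of $v$, $h_v\in H^1(\Gamma,\mathbb{Z})$ is the class of the circle at $v$ (the class of a small leg attached to it), $c(v)$ is the colour of $v$, and $\kappa_a,\kappa_b,\kappa_c\in\mathbb{Q}$ are arbitrary normalization constants (for instance $\frac14$). Put $Y^{\rm rat}_{p,q}=\sum_T T^{\rm rat}$, over the tree components $T$ of $X_{p,q}$ with at least one edge, taken with their coefficients. **Proposition.** Let $r\ge 1$ be coprime to $p$ and $q$. Then $$\mathrm{lift}_r\,Y^{\rm rat}_{p,q}=\Pi_r\,Y^{\rm rat}_{p,q}.$$ Moreover, on $\mathbb{Q}(t)\subset F(\mathbb{Z})$,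 with $t=\exp(1)$, one has $\mathrm{lift}_r(D^i h_n)=r^i D^i h_n$ for all $i\ge 0$ and all integers $n\ne 0$ coprime to $r$. -/

import Mathlib

noncomputable section

set_option linter.unusedSectionVars false

namespace TorusLift

/-! # Rational functions on the torus of a lattice -/

section Lattice

variable (H : Type) [AddCommGroup H]

/-- `ℚ[exp(H)]`: the group algebra of `H`, with basis the symbols `exp(μ)`, `μ ∈ H`. -/
abbrev ExpAlg : Type := AddMonoidAlgebra ℚ H

variable {H}

/-- The basis element `exp(μ)`. -/
def expo (μ : H) : ExpAlg H := AddMonoidAlgebra.single μ (1 : ℚ)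

variable (H)

/-- The multiplicative set `S` of products of non-zero elements `P(exp(h))`, with `P` a polynomial
in one variable and `h ∈ H`. -/
def denoms : Submonoid (ExpAlg H) :=
  Submonoid.closure
    {x | x ≠ 0 ∧ ∃ (P : Polynomial ℚ) (h : H), x = Polynomial.aeval (expo h) P}

/-- `F(H) = S⁻¹ ℚ[exp(H)]`. -/
def ExpFrac : Type := Localization (denoms H)

instance : CommRing (ExpFrac H) := inferInstanceAs (CommRing (Localization (denoms H)))

instance : Algebra (ExpAlg H) (ExpFrac H) :=
  inferInstanceAs (Algebra (ExpAlg H) (Localization (denoms H)))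

instance : IsLocalization (denoms H) (ExpFrac H) :=
  inferInstanceAs (IsLocalization (denoms H) (Localization (denoms H)))

instance : Algebra ℚ (ExpFrac H) := inferInstanceAs (Algebra ℚ (Localization (denoms H)))

instance : IsScalarTower ℚ (ExpAlg H) (ExpFrac H) :=
  inferInstanceAs (IsScalarTower ℚ (ExpAlg H) (Localization (denoms H)))

variable {H}

/-- The canonical map `ℚ[exp(H)] → S⁻¹ ℚ[exp(H)]`. -/
abbrev toRat (a : ExpAlg H) : ExpFrac H := algebraMap (ExpAlg H) (ExpFrac H) a

/-- Functoriality of `ℚ[exp(H)]` for isomorphisms of lattices. -/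
def expCongr {H H' : Type} [AddCommGroup H] [AddCommGroup H'] (e : H ≃+ H') :
    ExpAlg H ≃ₐ[ℚ] ExpAlg H' :=
  AddMonoidAlgebra.domCongr ℚ ℚ e

theorem expCongr_expo {H H' : Type} [AddCommGroup H] [AddCommGroup H'] (e : H ≃+ H') (μ : H) :
    expCongr e (expo μ) = expo (e μ) := by
  simp [expCongr, expo]

theorem denoms_le_comap {H H' : Type} [AddCommGroup H] [AddCommGroup H'] (e : H ≃+ H') :
    denoms H ≤ (denoms H').comap (expCongr e).toAlgHom.toRingHom := by
  refine Submonoid.closure_le.2 ?_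
  rintro _ ⟨hx, P, h, rfl⟩
  refine Submonoid.subset_closure ⟨?_, P, e h, ?_⟩
  · exact fun h0 => hx ((expCongr e).injective (h0.trans (map_zero _).symm))
  · change expCongr e _ = _
    rw [← expCongr_expo, Polynomial.aeval_algHom_apply (expCongr e)]

/-- Functoriality of `F(H) = S⁻¹ ℚ[exp(H)]` for isomorphisms of lattices. -/
def ratMap {H H' : Type} [AddCommGroup H] [AddCommGroup H'] (e : H ≃+ H') :
    ExpFrac H →ₐ[ℚ] ExpFrac H' :=
  { IsLocalization.map (ExpFrac H') (expCongr e).toAlgHom.toRingHom (denoms_le_comap e) with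
    commutes' := fun c => by
      have h1 : algebraMap ℚ (ExpFrac H) c = toRat (algebraMap ℚ (ExpAlg H) c) :=
        IsScalarTower.algebraMap_apply ℚ (ExpAlg H) (ExpFrac H) c
      have h2 : algebraMap ℚ (ExpFrac H') c = toRat (algebraMap ℚ (ExpAlg H') c) :=
        IsScalarTower.algebraMap_apply ℚ (ExpAlg H') (ExpFrac H') c
      change IsLocalization.map (ExpFrac H') (expCongr e).toAlgHom.toRingHom (denoms_le_comap e) _ = _
      rw [h1, h2, toRat, IsLocalization.map_eq]
      exact congrArg _ ((expCongr e).toAlgHom.commutes c) }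

theorem ratMap_toRat {H H' : Type} [AddCommGroup H] [AddCommGroup H'] (e : H ≃+ H')
    (a : ExpAlg H) : ratMap e (toRat a) = toRat (expCongr e a) :=
  IsLocalization.map_eq (denoms_le_comap e) a

end Lattice

section Lift

variable {H : Type} [AddCommGroup H] (r : ℕ)

/-- The substitution `exp(μ) ↦ exp(r μ)`, that is `t ↦ t ^ r`. -/
def frob : ExpAlg H →ₐ[ℚ] ExpAlg H :=
  AddMonoidAlgebra.mapDomainAlgHom ℚ ℚ (nsmulAddMonoidHom r : H →+ H)

theorem frob_expo (μ : H) : frob r (expo μ) = expo (r • μ) := by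
  simp [frob, expo]

variable [IsAddTorsionFree H] [NeZero r]

theorem nsmul_inj : Function.Injective (fun μ : H => r • μ) :=
  nsmul_right_injective (NeZero.ne r)

/-- Keep the exponents divisible by `r` and divide them by `r`:
`exp(r μ) ↦ exp(μ)`, and `exp(μ) ↦ 0` if `μ` is not divisible by `r`. -/
def keep : ExpAlg H →ₗ[ℚ] ExpAlg H where
  toFun a := AddMonoidAlgebra.comapDomain (fun μ : H => r • μ) (nsmul_inj r) a
  map_add' a b := AddMonoidAlgebra.comapDomain_add _ _ a b
  map_smul' c a := by ext μ; simp

theorem keep_expo_smul (μ : H) : keep r (expo (r • μ)) = expo μ := by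
  ext ν
  by_cases h : μ = ν
  · subst h; simp [keep, expo]
  · have := h
    simp [keep, expo, h]

theorem keep_expo_of_not_dvd (μ : H) (h : ∀ ν : H, r • ν ≠ μ) : keep r (expo μ) = 0 := by
  ext ν
  simp [keep, expo, (h ν).symm]

theorem keep_frob_mul (a b : ExpAlg H) : keep r (frob r a * b) = a * keep r b := by
  induction a using AddMonoidAlgebra.induction_linear with
  | zero => simp
  | add x y hx hy => simp [add_mul, hx, hy]
  | single μ c =>
    induction b using AddMonoidAlgebra.induction_linear with
    | zero => simp
    | add x y hx hy => simp [mul_add, hx, hy]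
    | single ν d =>
      have e1 : (AddMonoidAlgebra.single μ c : ExpAlg H) = c • expo μ := by simp [expo]
      have e2 : (AddMonoidAlgebra.single ν d : ExpAlg H) = d • expo ν := by simp [expo]
      have e3 : ∀ x y : H, expo x * expo y = expo (x + y) := fun x y => by simp [expo]
      rw [e1, e2]
      simp only [map_smul, smul_mul_assoc, mul_smul_comm]
      congr 2
      rw [frob_expo, e3]
      by_cases h : ∃ κ : H, r • κ = ν
      · obtain ⟨κ, rfl⟩ := h
        rw [← smul_add, keep_expo_smul, keep_expo_smul, e3]
      · have h1 : ∀ κ : H, r • κ ≠ ν := fun κ hk => h ⟨κ, hk⟩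
        rw [keep_expo_of_not_dvd r ν h1, mul_zero]
        refine keep_expo_of_not_dvd r _ fun κ hk => h1 (κ - μ) ?_
        rw [smul_sub, hk]; abel

theorem frob_injective : Function.Injective (frob r : ExpAlg H → ExpAlg H) := by
  intro a b hab
  have h : ∀ x : ExpAlg H, keep r (frob r x) = x * keep r 1 := fun x => by
    rw [← keep_frob_mul, mul_one]
  have h1 : keep r (1 : ExpAlg H) = 1 := by
    have := keep_expo_smul r (0 : H)
    simpa [expo, AddMonoidAlgebra.one_def] using this
  have := congrArg (keep r) hab
  simpa [h, h1] using this

theorem exists_expand_multiple (P : Polynomial ℚ) (hP : P ≠ 0) :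
    ∃ Q : Polynomial ℚ, Q ≠ 0 ∧ P ∣ Polynomial.expand ℚ r Q := by
  have hfin : Module.Finite ℚ (AdjoinRoot P) := (AdjoinRoot.powerBasis hP).finite
  have hint : IsIntegral ℚ ((AdjoinRoot.root P) ^ r) := Algebra.IsIntegral.isIntegral _
  refine ⟨minpoly ℚ ((AdjoinRoot.root P) ^ r), minpoly.ne_zero hint, ?_⟩
  rw [← AdjoinRoot.mk_eq_zero, ← AdjoinRoot.aeval_eq, Polynomial.expand_aeval, minpoly.aeval]

theorem nsmul_inj_aux {H : Type} [AddCommGroup H] [IsAddTorsionFree H] {h : H} (hh : h ≠ 0) {m n : ℕ} (e : m • h = n • h) : m = n := by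
  have h1 : ((m : ℤ) - n) • h = 0 := by rw [sub_smul, natCast_zsmul, natCast_zsmul, e, sub_self]
  rw [IsAddTorsionFree.zsmul_eq_zero_iff_left hh] at h1
  omega

theorem coeff_aeval_expo (h : H) (hh : h ≠ 0) (P : Polynomial ℚ) (n : ℕ) :
    (Polynomial.aeval (expo h) P).coeff (n • h) = P.coeff n := by
  induction P using Polynomial.induction_on' with
  | add p q hp hq => simp [hp, hq]
  | monomial m c =>
    have hinj : m • h = n • h ↔ m = n :=
      ⟨fun e => nsmul_inj_aux hh e, fun e => by rw [e]⟩
    by_cases hmn : m = n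
    · subst hmn
      simp [Polynomial.aeval_monomial, expo, AddMonoidAlgebra.single_pow]
    · have : m • h ≠ n • h := fun e => hmn (hinj.1 e)
      simp [Polynomial.aeval_monomial, expo, AddMonoidAlgebra.single_pow, this,
        Polynomial.coeff_monomial, hmn]

theorem aeval_expo_ne_zero (h : H) (hh : h ≠ 0) (P : Polynomial ℚ) (hP : P ≠ 0) :
    Polynomial.aeval (expo h) P ≠ 0 := by
  intro h0
  refine hP (Polynomial.ext fun n => ?_)
  rw [← coeff_aeval_expo h hh, h0]; simp

variable [AddMonoid.FG H]

theorem denoms_le_nonZeroDivisors : denoms H ≤ nonZeroDivisors (ExpAlg H) := by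
  refine Submonoid.closure_le.2 fun x hx => ?_
  exact mem_nonZeroDivisors_of_ne_zero hx.1

/-- Denominators can be expressed through `t ^ r`: each element of `S` divides the image of
an element of `S` under `t ↦ t ^ r`. -/
theorem exists_frob_multiple (s : ExpAlg H) (hs : s ∈ denoms H) :
    ∃ q ∈ denoms H, s ∣ frob r q := by
  induction hs using Submonoid.closure_induction with
  | one => exact ⟨1, one_mem _, one_dvd _⟩
  | mul x y _ _ hx hy =>
    obtain ⟨a, ha, hxa⟩ := hx
    obtain ⟨b, hb, hyb⟩ := hy
    exact ⟨a * b, mul_mem ha hb, by rw [map_mul]; exact mul_dvd_mul hxa hyb⟩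
  | mem x hx =>
    obtain ⟨hx0, P, h, rfl⟩ := hx
    by_cases hh : h = 0
    · subst hh
      refine ⟨_, Submonoid.subset_closure ⟨hx0, P, 0, rfl⟩, ?_⟩
      rw [← Polynomial.aeval_algHom_apply, frob_expo, smul_zero]
    · have hP : P ≠ 0 := by rintro rfl; simp at hx0
      obtain ⟨Q, hQ, hPQ⟩ := exists_expand_multiple r P hP
      refine ⟨_, Submonoid.subset_closure ⟨aeval_expo_ne_zero h hh Q hQ, Q, h, rfl⟩, ?_⟩
      have : frob r (Polynomial.aeval (expo h) Q)
          = Polynomial.aeval (expo h) (Polynomial.expand ℚ r Q) := by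
        rw [← Polynomial.aeval_algHom_apply, frob_expo, Polynomial.expand_aeval]
        congr 1
        simp [expo, AddMonoidAlgebra.single_pow]
      rw [this]
      exact map_dvd _ hPQ

/-- Each element of `S⁻¹ ℚ[exp(H)]` is a fraction whose denominator is expressed through
`t ^ r`. -/
theorem exists_frob_fraction (x : ExpFrac H) :
    ∃ (a : ExpAlg H) (q : denoms H), x * toRat (frob r q) = toRat a := by
  obtain ⟨n, s, rfl⟩ := IsLocalization.exists_mk'_eq (denoms H) x
  obtain ⟨q, hq, c, hc⟩ := exists_frob_multiple r s.1 s.2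
  refine ⟨n * c, ⟨q, hq⟩, ?_⟩
  change _ * toRat (frob r q) = _
  rw [hc, toRat, map_mul, ← mul_assoc, IsLocalization.mk'_spec, ← map_mul]

theorem toRat_injective : Function.Injective (toRat : ExpAlg H → ExpFrac H) :=
  IsLocalization.injective (ExpFrac H) denoms_le_nonZeroDivisors

theorem lift_well_defined {x : ExpFrac H} {a b : ExpAlg H} {q s : denoms H}
    (ha : x * toRat (frob r q) = toRat a) (hb : x * toRat (frob r s) = toRat b) :
    IsLocalization.mk' (ExpFrac H) (keep r a) q = IsLocalization.mk' (ExpFrac H) (keep r b) s := by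
  have h : frob r s * a = frob r q * b := by
    apply toRat_injective
    rw [toRat, toRat, map_mul, map_mul]
    change toRat _ * toRat _ = toRat _ * toRat _
    rw [← ha, ← hb]; ring
  have h2 := congrArg (keep r) h
  rw [keep_frob_mul, keep_frob_mul] at h2
  rw [IsLocalization.mk'_eq_iff_eq, h2]

/-- The underlying function of `lift_r` on `S⁻¹ ℚ[exp(H)]`. -/
def liftFun (x : ExpFrac H) : ExpFrac H :=
  IsLocalization.mk' (ExpFrac H) (keep r (exists_frob_fraction r x).choose)
    (exists_frob_fraction r x).choose_spec.choose

theorem liftFun_eq {x : ExpFrac H} {a : ExpAlg H} {q : denoms H}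
    (h : x * toRat (frob r q) = toRat a) :
    liftFun r x = IsLocalization.mk' (ExpFrac H) (keep r a) q :=
  lift_well_defined r (exists_frob_fraction r x).choose_spec.choose_spec h

/-- The operator `lift_r` on decorations: write `x` as a fraction `a / q(t ^ r)`, keep in `a` the
exponents divisible by `r`, divide them by `r`, and put back the denominator `q(t)`. -/
def liftRat : ExpFrac H →ₗ[ℚ] ExpFrac H where
  toFun := liftFun r
  map_add' x y := by
    obtain ⟨a, q, hx⟩ := exists_frob_fraction r x
    obtain ⟨b, s, hy⟩ := exists_frob_fraction r y
    have hxy : (x + y) * toRat (frob r (q * s : denoms H))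
        = toRat (frob r s * a + frob r q * b) := by
      simp only [Submonoid.coe_mul, map_mul, toRat, map_add] at hx hy ⊢
      rw [← hx, ← hy]; ring
    rw [liftFun_eq r hx, liftFun_eq r hy, liftFun_eq r hxy, ← IsLocalization.mk'_add, map_add,
      keep_frob_mul, keep_frob_mul]
    congr 1; ring
  map_smul' c x := by
    obtain ⟨a, q, hx⟩ := exists_frob_fraction r x
    have hs : ∀ a : ExpAlg H, toRat (c • a) = c • toRat a := fun a =>
      (IsScalarTower.toAlgHom ℚ (ExpAlg H) (ExpFrac H)).map_smul_of_tower c a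
    have hcx : (c • x) * toRat (frob r q) = toRat (c • a) := by
      rw [smul_mul_assoc, hx, hs]
    rw [liftFun_eq r hx, liftFun_eq r hcx, map_smul, RingHom.id_apply,
      IsLocalization.mk'_eq_iff_eq_mul, smul_mul_assoc, IsLocalization.mk'_spec]
    exact hs _

/-- The defining property of `lift_r` on decorations. -/
theorem liftRat_mk' (a : ExpAlg H) (q : denoms H) (x : ExpFrac H)
    (h : x * toRat (frob r q) = toRat a) :
    liftRat r x = IsLocalization.mk' (ExpFrac H) (keep r a) q :=
  liftFun_eq r h

end Lift

section LiftNatural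

variable {H H' : Type} [AddCommGroup H] [AddCommGroup H'] [IsAddTorsionFree H]
  [IsAddTorsionFree H'] [AddMonoid.FG H] [AddMonoid.FG H'] (r : ℕ) [NeZero r]

theorem expCongr_frob (e : H ≃+ H') (a : ExpAlg H) :
    expCongr e (frob r a) = frob r (expCongr e a) := by
  induction a using AddMonoidAlgebra.induction_linear with
  | zero => simp
  | add x y hx hy => simp [hx, hy]
  | single μ c =>
    have e1 : (AddMonoidAlgebra.single μ c : ExpAlg H) = c • expo μ := by simp [expo]
    rw [e1]
    simp [expCongr_expo, frob_expo]

theorem expCongr_keep (e : H ≃+ H') (a : ExpAlg H) :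
    expCongr e (keep r a) = keep r (expCongr e a) := by
  ext μ
  simp [expCongr, keep]

theorem liftRat_ratMap (e : H ≃+ H') (x : ExpFrac H) :
    liftRat r (ratMap e x) = ratMap e (liftRat r x) := by
  obtain ⟨a, q, hx⟩ := exists_frob_fraction r x
  have hq : expCongr e (q : ExpAlg H) ∈ denoms H' := denoms_le_comap e q.2
  have hx' : ratMap e x * toRat (frob r ((⟨_, hq⟩ : denoms H') : ExpAlg H'))
      = toRat (expCongr e a) := by
    have := congrArg (ratMap e) hx
    rwa [map_mul, ratMap_toRat, ratMap_toRat, expCongr_frob] at this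
  rw [liftRat_mk' r _ _ _ hx, liftRat_mk' r _ _ _ hx']
  rw [← expCongr_keep]
  exact (IsLocalization.map_mk' (denoms_le_comap e) _ _).symm

end LiftNatural


/-! # The operator `D = t d/dt` and the functions `h_n` -/

section OneVariable

/-- The derivative of a rational function, by the quotient rule. -/
def ratDeriv (g : RatFunc ℚ) : RatFunc ℚ :=
  (algebraMap (Polynomial ℚ) (RatFunc ℚ)
      (Polynomial.derivative g.num * g.denom - g.num * Polynomial.derivative g.denom)) /
    (algebraMap (Polynomial ℚ) (RatFunc ℚ) g.denom) ^ 2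

/-- The operator `D g (t) = t g'(t)` on `ℚ(t)`. -/
def opD (g : RatFunc ℚ) : RatFunc ℚ := RatFunc.X * ratDeriv g

/-- `h_n(t) = (t ^ n + 1) / (t ^ n - 1)` for a non-zero integer `n`. -/
def hFun (n : ℤ) : RatFunc ℚ := (RatFunc.X ^ n + 1) / (RatFunc.X ^ n - 1)

/-- The element `g(exp(h))` of `S⁻¹ ℚ[exp(H)]`, for `g ∈ ℚ(t)` and `0 ≠ h ∈ H`. -/
def evalExp {H : Type} [AddCommGroup H] (h : H) (g : RatFunc ℚ) : ExpFrac H :=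
  toRat (Polynomial.aeval (expo h) g.num) *
    Ring.inverse (toRat (Polynomial.aeval (expo h) g.denom))

end OneVariable

/-! # Trivalent graphs and their first cohomology -/

/-- A finite trivalent graph with local orientations at the vertices, possibly with circle
components. `Dart` is the set of oriented edges, `inv` reverses the orientation. A vertex is an
orbit with three elements of `next`: the darts starting at the vertex, in the cyclic order given by
the local orientation. A dart fixed by `next` does not start at a vertex; such a dart and its
reverse are the two orientations of a circle component. -/
structure TriGraph where
  Dart : Type
  [fin : Finite Dart]
  inv : Dart → Dart
  inv_inv : ∀ d, inv (inv d) = d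
  inv_ne : ∀ d, inv d ≠ d
  next : Equiv.Perm Dart
  next_three : ∀ d, next (next (next d)) = d
  next_inv : ∀ d, next d = d → next (inv d) = inv d

attribute [instance] TriGraph.fin

instance (Γ : TriGraph) : DecidableEq Γ.Dart := Classical.decEq _

namespace TriGraph

variable (Γ : TriGraph)

/-- The number of darts which start at a vertex. -/
def numAttached : ℕ := Nat.card {d : Γ.Dart // Γ.next d ≠ d}

/-- The Euler characteristic: number of vertices minus number of edges (the circle components
contribute `0`). -/
def eulerChar : ℤ := (Γ.numAttached / 3 : ℕ) - (Γ.numAttached / 2 : ℕ)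

/-- Integral 1-cochains: functions on oriented edges which change sign with the orientation. -/
def cochains : AddSubgroup (Γ.Dart → ℤ) where
  carrier := {c | ∀ d, c (Γ.inv d) = - c d}
  zero_mem' := fun d => by simp
  add_mem' := fun {a b} ha hb d => by
    have h1 : a (Γ.inv d) = - a d := ha d
    have h2 : b (Γ.inv d) = - b d := hb d
    simp [h1, h2]; ring
  neg_mem' := fun {a} ha d => by
    have h1 : a (Γ.inv d) = - a d := ha d
    simp [h1]

/-- Integral functions on the vertices, written as functions of the darts: the value at a dart is
the value at its starting point (and a function is constant on a circle component). -/
def IsPotential (g : Γ.Dart → ℤ) : Prop :=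
  (∀ d, g (Γ.next d) = g d) ∧ ∀ d, Γ.next d = d → g (Γ.inv d) = g d

/-- Coboundaries of functions on the vertices. -/
def coboundaries : AddSubgroup Γ.cochains where
  carrier := {c | ∃ g, Γ.IsPotential g ∧ ∀ d, c.1 d = g (Γ.inv d) - g d}
  zero_mem' := ⟨0, ⟨fun _ => rfl, fun _ _ => rfl⟩, fun d => by simp⟩
  add_mem' := by
    rintro a b ⟨g, hg, hga⟩ ⟨k, hk, hkb⟩
    refine ⟨g + k, ⟨fun d => ?_, fun d hd => ?_⟩, fun d => ?_⟩
    · simp [hg.1 d, hk.1 d]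
    · simp [hg.2 d hd, hk.2 d hd]
    · simp [hga, hkb]; ring
  neg_mem' := by
    rintro a ⟨g, hg, hga⟩
    refine ⟨-g, ⟨fun d => ?_, fun d hd => ?_⟩, fun d => ?_⟩
    · simp [hg.1 d]
    · simp [hg.2 d hd]
    · simp [hga]; ring

/-- `H¹(Γ, ℤ)`. -/
abbrev H1 : Type := Γ.cochains ⧸ Γ.coboundaries

/-- The class of a cochain. -/
def cls (c : Γ.cochains) : Γ.H1 := QuotientAddGroup.mk c

instance : AddMonoid.FG Γ.H1 := by
  have h1 : Module.Finite ℤ (AddSubgroup.toIntSubmodule Γ.cochains) := inferInstance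
  have h2 : Module.Finite ℤ Γ.cochains := h1
  have h3 : AddGroup.FG Γ.cochains := Module.Finite.iff_addGroup_fg.1 h2
  exact AddGroup.fg_iff_addMonoid_fg.1
    (AddGroup.fg_of_surjective (f := QuotientAddGroup.mk' Γ.coboundaries)
      (QuotientAddGroup.mk'_surjective _))

instance : IsAddTorsionFree Γ.H1 := by
  refine ⟨fun n hn x y hxy => ?_⟩
  obtain ⟨c, hc⟩ := QuotientAddGroup.mk_surjective (x - y)
  have h0 : n • (x - y) = 0 := by
    have := nsmul_sub x y n
    rw [this]; exact sub_eq_zero.2 hxy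
  rw [← hc, ← QuotientAddGroup.mk_nsmul, QuotientAddGroup.eq_zero_iff] at h0
  obtain ⟨g, hg, hgc⟩ := h0
  rw [← sub_eq_zero, ← hc, QuotientAddGroup.eq_zero_iff]
  refine ⟨fun d => g d / n, ⟨fun d => ?_, fun d hd => ?_⟩, fun d => ?_⟩
  · simp only [hg.1 d]
  · simp only [hg.2 d hd]
  · have h1 : (n : ℤ) * c.1 d = g (Γ.inv d) - g d := by
      rw [← hgc d]; simp
    have h2 : g (Γ.inv d) = g d + n * c.1 d := by rw [h1]; ring
    have hn' : (n : ℤ) ≠ 0 := by exact_mod_cast hn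
    simp only [h2, Int.add_mul_ediv_left _ _ hn']
    ring

/-! ## Local modifications of a graph -/

theorem rewire_fixed_iff (τ : Equiv.Perm Γ.Dart) (hτ : ∀ d, Γ.next d = d → τ d = d) (d : Γ.Dart) :
    (τ.symm.trans (Γ.next.trans τ)) d = d ↔ Γ.next d = d := by
  constructor
  · intro h
    have h1 : Γ.next (τ.symm d) = τ.symm d := by
      apply τ.injective
      simpa using h
    have h2 := hτ _ h1
    simp only [Equiv.apply_symm_apply] at h2
    rwa [← h2] at h1
  · intro h
    have h1 : τ.symm d = d := by
      rw [Equiv.symm_apply_eq]; exact (hτ d h).symm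
    simp [h1, h, hτ d h]

/-- The graph with the same edges, in which the cyclic orders at the vertices are transported along
a permutation `τ` of the darts which start at a vertex. -/
def rewire (τ : Equiv.Perm Γ.Dart) (hτ : ∀ d, Γ.next d = d → τ d = d) : TriGraph where
  Dart := Γ.Dart
  inv := Γ.inv
  inv_inv := Γ.inv_inv
  inv_ne := Γ.inv_ne
  next := τ.symm.trans (Γ.next.trans τ)
  next_three d := by simp [Γ.next_three]
  next_inv d h := (Γ.rewire_fixed_iff τ hτ _).2 (Γ.next_inv d ((Γ.rewire_fixed_iff τ hτ d).1 h))

theorem numAttached_rewire (τ : Equiv.Perm Γ.Dart) (hτ : ∀ d, Γ.next d = d → τ d = d) :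
    (Γ.rewire τ hτ).numAttached = Γ.numAttached := by
  have : ∀ d : Γ.Dart, (Γ.rewire τ hτ).next d ≠ d ↔ Γ.next d ≠ d := fun d =>
    not_congr (Γ.rewire_fixed_iff τ hτ d)
  exact Nat.card_congr (Equiv.subtypeEquivRight this)

theorem isPotential_rewire (τ : Equiv.Perm Γ.Dart) (hτ : ∀ d, Γ.next d = d → τ d = d)
    (g : Γ.Dart → ℤ) (hg : ∀ d, g (τ d) = g d) :
    (Γ.rewire τ hτ).IsPotential g ↔ Γ.IsPotential g := by
  have hg' : ∀ d, g (τ.symm d) = g d := fun d => by rw [← hg, Equiv.apply_symm_apply]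
  have h1 : (∀ d, g ((τ.symm.trans (Γ.next.trans τ)) d) = g d) ↔ ∀ d, g (Γ.next d) = g d := by
    constructor
    · intro h d
      have := h (τ d)
      simpa [hg] using this
    · intro h d
      simp [hg, h, hg']
  exact and_congr h1 (forall_congr' fun d => imp_congr (Γ.rewire_fixed_iff τ hτ d) Iff.rfl)

end TriGraph

/-- Two quotients of `M` are identified if they are quotients, with the same kernel, of a subgroup
`C` of `M`; the identification is the identity on representatives in `C`. -/
def quotIdent {M : Type} [AddCommGroup M] (C B B' : AddSubgroup M)
    (h : ∀ x, ∃ y ∈ C, x - y ∈ B) (h' : ∀ x, ∃ y ∈ C, x - y ∈ B')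
    (hk : ∀ y ∈ C, y ∈ B ↔ y ∈ B') : M ⧸ B ≃+ M ⧸ B' :=
  let φ : C →+ M ⧸ B := (QuotientAddGroup.mk' B).comp C.subtype
  let φ' : C →+ M ⧸ B' := (QuotientAddGroup.mk' B').comp C.subtype
  have hφ : Function.Surjective φ := fun z => by
    obtain ⟨x, rfl⟩ := QuotientAddGroup.mk_surjective z
    obtain ⟨y, hy, hxy⟩ := h x
    refine ⟨⟨y, hy⟩, ?_⟩
    exact (QuotientAddGroup.eq_iff_sub_mem.2 hxy).symm
  have hφ' : Function.Surjective φ' := fun z => by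
    obtain ⟨x, rfl⟩ := QuotientAddGroup.mk_surjective z
    obtain ⟨y, hy, hxy⟩ := h' x
    refine ⟨⟨y, hy⟩, ?_⟩
    exact (QuotientAddGroup.eq_iff_sub_mem.2 hxy).symm
  have hker : φ.ker = φ'.ker := by
    ext y
    simp only [AddMonoidHom.mem_ker, φ, φ', AddMonoidHom.comp_apply, AddSubgroup.subtype_apply,
      QuotientAddGroup.mk'_apply, QuotientAddGroup.eq_zero_iff]
    exact hk y.1 y.2
  ((QuotientAddGroup.quotientKerEquivOfSurjective φ hφ).symm.trans
    (QuotientAddGroup.quotientAddEquivOfEq hker)).trans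
    (QuotientAddGroup.quotientKerEquivOfSurjective φ' hφ')

theorem quotIdent_mk {M : Type} [AddCommGroup M] (C B B' : AddSubgroup M)
    (h : ∀ x, ∃ y ∈ C, x - y ∈ B) (h' : ∀ x, ∃ y ∈ C, x - y ∈ B')
    (hk : ∀ y ∈ C, y ∈ B ↔ y ∈ B') (y : M) (hy : y ∈ C) :
    quotIdent C B B' h h' hk (QuotientAddGroup.mk y) = QuotientAddGroup.mk y := by
  have : ∀ (φ : C →+ M ⧸ B) (hs : Function.Surjective φ) (z : M ⧸ B) (y : C), φ y = z →
      (QuotientAddGroup.quotientKerEquivOfSurjective φ hs).symm z = QuotientAddGroup.mk y := by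
    intro φ hs z y hz
    rw [AddEquiv.symm_apply_eq]
    exact hz.symm
  unfold quotIdent
  simp only [AddEquiv.trans_apply]
  generalize_proofs h1 h2 h3 h4 h5 h6 h7
  erw [this _ h7 _ ⟨y, hy⟩ rfl]
  rfl

namespace TriGraph

variable (Γ : TriGraph)

/-! ### Change of the orientation of a vertex -/

/-- The transposition of the two darts which follow `d` at its vertex. -/
def flipPerm (d : Γ.Dart) : Equiv.Perm Γ.Dart :=
  Equiv.swap (Γ.next d) (Γ.next (Γ.next d))

theorem next_ne {d : Γ.Dart} (hd : Γ.next d ≠ d) :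
    Γ.next (Γ.next d) ≠ Γ.next d ∧ Γ.next (Γ.next d) ≠ d := by
  refine ⟨fun h => hd (Γ.next.injective h), fun h => hd ?_⟩
  have h3 := Γ.next_three d
  rwa [h] at h3

theorem flipPerm_fix (d : Γ.Dart) (u : Γ.Dart) (hu : Γ.next u = u) : Γ.flipPerm d u = u := by
  by_cases hd : Γ.next d = d
  · simp [flipPerm, hd]
  · apply Equiv.swap_apply_of_ne_of_ne
    · rintro rfl
      exact (Γ.next_ne hd).1 hu
    · rintro rfl
      rw [Γ.next_three] at hu
      exact (Γ.next_ne hd).2 hu.symm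

/-- The graph in which the orientation of the vertex at the start of `d` is reversed. -/
def flip (d : Γ.Dart) : TriGraph := Γ.rewire (Γ.flipPerm d) (Γ.flipPerm_fix d)

theorem coboundaries_flip (d : Γ.Dart) (c : Γ.cochains) :
    c ∈ Γ.coboundaries ↔ c ∈ (show AddSubgroup Γ.cochains from (Γ.flip d).coboundaries) := by
  have key : ∀ g : Γ.Dart → ℤ, (Γ.flip d).IsPotential g ↔ Γ.IsPotential g := by
    intro g
    by_cases hg : g (Γ.next d) = g (Γ.next (Γ.next d))
    · refine Γ.isPotential_rewire _ _ g fun u => ?_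
      unfold flipPerm
      rcases Equiv.swap_apply_def (Γ.next d) (Γ.next (Γ.next d)) u with h
      rw [h]
      split_ifs with h1 h2
      · rw [h1, hg]
      · rw [h2, hg]
      · rfl
    · refine iff_of_false (fun h => hg ?_) (fun h => hg ?_)
      · by_cases hd : Γ.next d = d
        · simp [hd]
        · obtain ⟨n1, n2⟩ := Γ.next_ne hd
          have e1 : Γ.flipPerm d d = d :=
            Equiv.swap_apply_of_ne_of_ne (Ne.symm hd) (Ne.symm n2)
          have e2 : Γ.flipPerm d (Γ.next d) = Γ.next (Γ.next d) := Equiv.swap_apply_left _ _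
          have e1' : (Γ.flipPerm d).symm d = d := by rw [Equiv.symm_apply_eq]; exact e1.symm
          have e2' : (Γ.flipPerm d).symm (Γ.next d) = Γ.next (Γ.next d) := by
            rw [Equiv.symm_apply_eq]; exact (Equiv.swap_apply_right _ _).symm
          have a1 : (Γ.flip d).next d = Γ.next (Γ.next d) := by
            change (Γ.flipPerm d) (Γ.next ((Γ.flipPerm d).symm d)) = _
            rw [e1', e2]
          have a2 : (Γ.flip d).next (Γ.next d) = d := by
            change (Γ.flipPerm d) (Γ.next ((Γ.flipPerm d).symm (Γ.next d))) = _
            rw [e2', Γ.next_three, e1]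
          have b1 := h.1 d
          have b2 := h.1 (Γ.next d)
          rw [a1] at b1
          rw [a2] at b2
          rw [b1, b2]
      · rw [h.1 (Γ.next d)]
  exact exists_congr fun g => and_congr (key g).symm Iff.rfl

/-- The canonical identification of the cohomology of `Γ` with that of `Γ.flip d`. -/
def flipCoh (d : Γ.Dart) : Γ.H1 ≃+ (Γ.flip d).H1 :=
  quotIdent (M := Γ.cochains) ⊤ Γ.coboundaries (Γ.flip d).coboundaries
    (fun x => ⟨x, trivial, by simp⟩)
    (fun x => ⟨x, trivial, by rw [sub_self]; exact (Γ.flip d).coboundaries.zero_mem⟩)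
    (fun y _ => Γ.coboundaries_flip d y)

/-! ### The three resolutions of a four-valent vertex -/

/-- The edge `d` has two distinct end points, so that it can be contracted to a four-valent
vertex. -/
def IsContractible (d : Γ.Dart) : Prop :=
  Γ.next d ≠ d ∧ Γ.inv d ≠ Γ.next d ∧ Γ.inv d ≠ Γ.next (Γ.next d)

/-- The three darts `next d`, `next (next d)` and `next (inv d)`: three of the four darts which
start at the four-valent vertex obtained by contracting `d`. -/
def IsCorner (d u : Γ.Dart) : Prop :=
  u = Γ.next d ∨ u = Γ.next (Γ.next d) ∨ u = Γ.next (Γ.inv d)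

variable {Γ}

theorem IsContractible.inv_attached {d : Γ.Dart} (hd : Γ.IsContractible d) :
    Γ.next (Γ.inv d) ≠ Γ.inv d := fun h => hd.1 (by simpa [Γ.inv_inv] using Γ.next_inv _ h)

theorem corner_fix {d : Γ.Dart} (hd : Γ.IsContractible d) {τ : Equiv.Perm Γ.Dart}
    (hτ : ∀ u, τ u ≠ u → Γ.IsCorner d u) (u : Γ.Dart) (hu : Γ.next u = u) : τ u = u := by
  by_contra h
  rcases hτ u h with rfl | rfl | rfl
  · exact (Γ.next_ne hd.1).1 hu
  · rw [Γ.next_three] at hu; exact (Γ.next_ne hd.1).2 hu.symm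
  · exact hd.inv_attached (Γ.next.injective hu)

/-- Each cohomology class has a representative which vanishes on a contractible edge. -/
theorem exists_vanishing {d : Γ.Dart} (hd : Γ.IsContractible d) (x : Γ.cochains) :
    ∃ y : Γ.cochains, y.1 d = 0 ∧ x - y ∈ Γ.coboundaries := by
  let g : Γ.Dart → ℤ := fun u =>
    if u = d ∨ u = Γ.next d ∨ u = Γ.next (Γ.next d) then x.1 d else 0
  have hg : Γ.IsPotential g := by
    have key : ∀ u, (Γ.next u = d ∨ Γ.next u = Γ.next d ∨ Γ.next u = Γ.next (Γ.next d)) ↔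
        (u = d ∨ u = Γ.next d ∨ u = Γ.next (Γ.next d)) := by
      intro u
      have h1 : Γ.next u = d ↔ u = Γ.next (Γ.next d) := by
        constructor
        · rintro rfl; exact (Γ.next_three u).symm
        · rintro rfl; exact Γ.next_three d
      simp only [h1, Γ.next.injective.eq_iff]
      tauto
    have key2 : ∀ u, Γ.next u = u → ¬ (u = d ∨ u = Γ.next d ∨ u = Γ.next (Γ.next d)) := by
      rintro u hu (rfl | rfl | rfl)
      · exact hd.1 hu
      · exact (Γ.next_ne hd.1).1 hu
      · rw [Γ.next_three] at hu; exact (Γ.next_ne hd.1).2 hu.symm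
    refine ⟨fun u => ?_, fun u hu => ?_⟩
    · simp only [g, key]
    · simp only [g, if_neg (key2 u hu), if_neg (key2 _ (Γ.next_inv u hu))]
  let b : Γ.cochains := ⟨fun u => g (Γ.inv u) - g u, fun u => by simp [Γ.inv_inv]⟩
  have hb : b ∈ Γ.coboundaries := ⟨g, hg, fun _ => rfl⟩
  refine ⟨x + b, ?_, ?_⟩
  · have h1 : g d = x.1 d := by simp [g]
    have h2 : g (Γ.inv d) = 0 := by
      have : ¬ (Γ.inv d = d ∨ Γ.inv d = Γ.next d ∨ Γ.inv d = Γ.next (Γ.next d)) := by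
        rintro (h | h | h)
        · exact Γ.inv_ne d h
        · exact hd.2.1 h
        · exact hd.2.2 h
      simp only [g, if_neg this]
    change x.1 d + (g (Γ.inv d) - g d) = 0
    rw [h1, h2]; ring
  · have : x - (x + b) = -b := by abel
    rw [this]
    exact Γ.coboundaries.neg_mem hb

theorem corner_perm {d : Γ.Dart} (hd : Γ.IsContractible d) {τ : Equiv.Perm Γ.Dart}
    (hτ : ∀ u, τ u ≠ u → Γ.IsCorner d u) :
    (Γ.rewire τ (corner_fix hd hτ)).next d = τ (Γ.next d) ∧
    (Γ.rewire τ (corner_fix hd hτ)).next (τ (Γ.next d)) = τ (Γ.next (Γ.next d)) ∧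
    (Γ.rewire τ (corner_fix hd hτ)).next (Γ.inv d) = τ (Γ.next (Γ.inv d)) := by
  have f1 : τ d = d := by
    by_contra h
    rcases hτ d h with h | h | h
    · exact hd.1 h.symm
    · exact (Γ.next_ne hd.1).2 h.symm
    · have : Γ.inv d = Γ.next (Γ.next d) := by rw [h, Γ.next_three]; rw [← h]
      exact hd.2.2 this
  have f2 : τ (Γ.inv d) = Γ.inv d := by
    by_contra h
    rcases hτ _ h with h | h | h
    · exact hd.2.1 h
    · exact hd.2.2 h
    · exact hd.inv_attached h.symm
  have f1' : τ.symm d = d := by rw [Equiv.symm_apply_eq]; exact f1.symm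
  have f2' : τ.symm (Γ.inv d) = Γ.inv d := by rw [Equiv.symm_apply_eq]; exact f2.symm
  refine ⟨?_, ?_, ?_⟩
  · change τ (Γ.next (τ.symm d)) = _
    rw [f1']
  · change τ (Γ.next (τ.symm (τ (Γ.next d)))) = _
    rw [Equiv.symm_apply_apply]
  · change τ (Γ.next (τ.symm (Γ.inv d))) = _
    rw [f2']

theorem isCorner_perm {d : Γ.Dart} {τ : Equiv.Perm Γ.Dart}
    (hτ : ∀ u, τ u ≠ u → Γ.IsCorner d u) {u : Γ.Dart} (hu : Γ.IsCorner d u) :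
    Γ.IsCorner d (τ u) := by
  by_cases h : τ u = u
  · rwa [h]
  · exact hτ _ fun h' => h (τ.injective h')

theorem isCorner_perm_symm {d : Γ.Dart} {τ : Equiv.Perm Γ.Dart}
    (hτ : ∀ u, τ u ≠ u → Γ.IsCorner d u) {u : Γ.Dart} (hu : Γ.IsCorner d u) :
    ∃ w, Γ.IsCorner d w ∧ τ w = u := by
  refine ⟨τ.symm u, ?_, by simp⟩
  by_cases h : τ (τ.symm u) = τ.symm u
  · rw [Equiv.apply_symm_apply] at h; rwa [← h]
  · exact hτ _ h

theorem contractible_rewire {d : Γ.Dart} (hd : Γ.IsContractible d) {τ : Equiv.Perm Γ.Dart}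
    (hτ : ∀ u, τ u ≠ u → Γ.IsCorner d u) :
    (Γ.rewire τ (corner_fix hd hτ)).IsContractible d := by
  obtain ⟨h1, h2, -⟩ := corner_perm hd hτ
  have key : ∀ u, Γ.IsCorner d u → Γ.inv d ≠ u := by
    rintro u (rfl | rfl | rfl)
    · exact hd.2.1
    · exact hd.2.2
    · exact hd.inv_attached.symm
  refine ⟨fun h => hd.1 ((Γ.rewire_fixed_iff τ (corner_fix hd hτ) d).1 h), ?_, ?_⟩
  · rw [h1]; exact key _ (isCorner_perm hτ (Or.inl rfl))
  · rw [h1, h2]; exact key _ (isCorner_perm hτ (Or.inr (Or.inl rfl)))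

theorem coboundaries_rewire {d : Γ.Dart} (hd : Γ.IsContractible d) {τ : Equiv.Perm Γ.Dart}
    (hτ : ∀ u, τ u ≠ u → Γ.IsCorner d u) (c : Γ.cochains) (hc : c.1 d = 0) :
    c ∈ Γ.coboundaries ↔
      c ∈ (show AddSubgroup Γ.cochains from
        (Γ.rewire τ (corner_fix hd hτ)).coboundaries) := by
  have key : ∀ g : Γ.Dart → ℤ, g (Γ.inv d) = g d →
      ((Γ.rewire τ (corner_fix hd hτ)).IsPotential g ↔ Γ.IsPotential g) := by
    intro g hgd
    by_cases hg : ∀ u, Γ.IsCorner d u → g u = g d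
    · refine Γ.isPotential_rewire _ _ g fun u => ?_
      by_cases hu : τ u = u
      · rw [hu]
      · rw [hg u (hτ u hu), hg _ (isCorner_perm hτ (hτ u hu))]
    · refine iff_of_false (fun h => hg fun u hu => ?_) (fun h => hg fun u hu => ?_)
      · obtain ⟨h1, h2, h3⟩ := corner_perm hd hτ
        have b1 := h.1 d
        rw [h1] at b1
        have b2 := h.1 (τ (Γ.next d))
        rw [h2] at b2
        have b3 := h.1 (Γ.inv d)
        rw [h3] at b3
        obtain ⟨w, hw, rfl⟩ := isCorner_perm_symm hτ hu
        rcases hw with rfl | rfl | rfl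
        · exact b1
        · exact b2.trans b1
        · exact b3.trans hgd
      · rcases hu with rfl | rfl | rfl
        · exact h.1 d
        · rw [h.1, h.1]
        · rw [h.1, hgd]
  refine exists_congr fun g => ?_
  constructor
  · rintro ⟨hg, hgc⟩
    have := hgc d
    rw [hc] at this
    exact ⟨(key g (by linarith)).2 hg, hgc⟩
  · rintro ⟨hg, hgc⟩
    have h : c.1 d = g (Γ.inv d) - g d := hgc d
    rw [hc] at h
    exact ⟨(key g (by linarith)).1 hg, hgc⟩

variable (Γ)

/-- Cochains which vanish on `d`, that is, cochains of the graph in which `d` is contracted. -/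
def vanishing (d : Γ.Dart) : AddSubgroup Γ.cochains where
  carrier := {c | c.1 d = 0}
  zero_mem' := rfl
  add_mem' := fun {a b} ha hb => by
    have h1 : a.1 d = 0 := ha
    have h2 : b.1 d = 0 := hb
    change a.1 d + b.1 d = 0
    rw [h1, h2, add_zero]
  neg_mem' := fun {a} ha => by
    have h1 : a.1 d = 0 := ha
    change - a.1 d = 0
    rw [h1, neg_zero]

variable {Γ}

/-- If the four ends at a contractible edge `d` are redistributed, the cohomology groups of both
graphs are identified with that of the graph in which `d` is contracted to a four-valent vertex. -/
def resolveCoh {d : Γ.Dart} (hd : Γ.IsContractible d) {τ : Equiv.Perm Γ.Dart}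
    (hτ : ∀ u, τ u ≠ u → Γ.IsCorner d u) :
    Γ.H1 ≃+ (Γ.rewire τ (corner_fix hd hτ)).H1 :=
  quotIdent (M := Γ.cochains) (Γ.vanishing d) Γ.coboundaries
    (Γ.rewire τ (corner_fix hd hτ)).coboundaries
    (fun x => exists_vanishing hd x)
    (fun x => exists_vanishing (contractible_rewire hd hτ) x)
    (fun y hy => coboundaries_rewire hd hτ y hy)

variable (Γ)

/-- The cyclic permutation `next d ↦ next (next d) ↦ next (inv d) ↦ next d`. -/
def cornerCycle (d : Γ.Dart) : Equiv.Perm Γ.Dart :=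
  Equiv.swap (Γ.next d) (Γ.next (Γ.next d)) * Equiv.swap (Γ.next (Γ.next d)) (Γ.next (Γ.inv d))

theorem cornerCycle_moves (d u : Γ.Dart) (hu : Γ.cornerCycle d u ≠ u) : Γ.IsCorner d u := by
  by_contra h
  unfold IsCorner at h
  push Not at h
  apply hu
  simp only [cornerCycle, Equiv.Perm.mul_apply]
  rw [Equiv.swap_apply_of_ne_of_ne h.2.1 h.2.2, Equiv.swap_apply_of_ne_of_ne h.1 h.2.1]

theorem cornerCycle_sq_moves (d u : Γ.Dart)
    (hu : (Γ.cornerCycle d * Γ.cornerCycle d) u ≠ u) : Γ.IsCorner d u := by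
  by_contra h
  have : Γ.cornerCycle d u = u := by
    by_contra h'
    exact h (Γ.cornerCycle_moves d u h')
  exact hu (by simp [this])

/-- An isomorphism of oriented trivalent graphs. -/
structure Iso (Γ Γ' : TriGraph) where
  toEquiv : Γ.Dart ≃ Γ'.Dart
  map_inv : ∀ d, toEquiv (Γ.inv d) = Γ'.inv (toEquiv d)
  map_next : ∀ d, toEquiv (Γ.next d) = Γ'.next (toEquiv d)

namespace Iso

variable {Γ} {Γ' : TriGraph} (φ : Iso Γ Γ')

/-- Pull-back of cochains. -/
def pullCochain : Γ'.cochains ≃+ Γ.cochains where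
  toFun c := ⟨fun d => c.1 (φ.toEquiv d), fun d => by
    change c.1 (φ.toEquiv (Γ.inv d)) = - c.1 (φ.toEquiv d)
    rw [φ.map_inv]; exact c.2 _⟩
  invFun c := ⟨fun d => c.1 (φ.toEquiv.symm d), fun d => by
    change c.1 (φ.toEquiv.symm (Γ'.inv d)) = - c.1 (φ.toEquiv.symm d)
    have : φ.toEquiv.symm (Γ'.inv d) = Γ.inv (φ.toEquiv.symm d) := by
      rw [Equiv.symm_apply_eq, φ.map_inv, Equiv.apply_symm_apply]
    rw [this]; exact c.2 _⟩
  left_inv c := by ext d; simp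
  right_inv c := by ext d; simp
  map_add' a b := rfl

theorem map_coboundaries :
    Γ'.coboundaries.map φ.pullCochain.toAddMonoidHom = Γ.coboundaries := by
  ext c
  constructor
  · rintro ⟨c, ⟨g, hg, hgc⟩, rfl⟩
    refine ⟨fun d => g (φ.toEquiv d), ⟨fun d => ?_, fun d hd => ?_⟩, fun d => ?_⟩
    · simp only [φ.map_next, hg.1]
    · simp only [φ.map_inv]
      exact hg.2 _ (by rw [← φ.map_next, hd])
    · change c.1 (φ.toEquiv d) = _
      simp only [hgc, φ.map_inv]
  · rintro ⟨g, hg, hgc⟩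
    have hn : ∀ d, φ.toEquiv.symm (Γ'.next d) = Γ.next (φ.toEquiv.symm d) := fun d => by
      rw [Equiv.symm_apply_eq, φ.map_next, Equiv.apply_symm_apply]
    have hi : ∀ d, φ.toEquiv.symm (Γ'.inv d) = Γ.inv (φ.toEquiv.symm d) := fun d => by
      rw [Equiv.symm_apply_eq, φ.map_inv, Equiv.apply_symm_apply]
    refine ⟨φ.pullCochain.symm c, ⟨fun d => g (φ.toEquiv.symm d),
      ⟨fun d => ?_, fun d hd => ?_⟩, fun d => ?_⟩, φ.pullCochain.apply_symm_apply c⟩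
    · simp only [hn, hg.1]
    · simp only [hi]
      exact hg.2 _ (by rw [← hn, hd])
    · change c.1 (φ.toEquiv.symm d) = _
      simp only [hgc, hi]

/-- The map `φ^* : H¹(Γ', ℤ) → H¹(Γ, ℤ)`. -/
def pull : Γ'.H1 ≃+ Γ.H1 :=
  QuotientAddGroup.congr _ _ φ.pullCochain φ.map_coboundaries

theorem numAttached_eq (φ : Iso Γ Γ') : Γ'.numAttached = Γ.numAttached := by
  refine (Nat.card_congr (Equiv.subtypeEquiv φ.toEquiv fun d => ?_)).symm
  rw [← φ.map_next, ne_eq, ne_eq, φ.toEquiv.injective.eq_iff]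

end Iso

end TriGraph

/-! # The space of diagrams `𝓑ˢʳᵃᵗ` and the operators on it -/

open Classical in
/-- The direct sum of the spaces `F(H¹(Γ, ℤ))` over all trivalent graphs. -/
abbrev PreDiag : Type 1 := DirectSum TriGraph fun Γ => ExpFrac Γ.H1

open Classical in
/-- The inclusion of the summand of `Γ`. -/
def gen (Γ : TriGraph) : ExpFrac Γ.H1 →ₗ[ℚ] PreDiag :=
  DirectSum.lof ℚ TriGraph (fun Γ => ExpFrac Γ.H1) Γ

/-- The relations between decorated graphs: isomorphisms, change of the orientation of a vertex,
and the relation between the three resolutions of a four-valent vertex. If the contracted edge `d`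
has the ends `(d, a, b)` and `(inv d, c, e)` in cyclic order, the resolutions have the ends
`(d, a, b), (inv d, c, e)`, then `(d, b, c), (inv d, a, e)`, then `(d, c, a), (inv d, b, e)`, and
their sum is zero; up to the orientation of a vertex this is `I = H - X`. -/
inductive Rel : PreDiag → Prop
  | iso {Γ Γ' : TriGraph} (φ : TriGraph.Iso Γ Γ') (x : ExpFrac Γ'.H1) :
      Rel (gen Γ' x - gen Γ (ratMap φ.pull x))
  | orient (Γ : TriGraph) (d : Γ.Dart) (hd : Γ.next d ≠ d) (x : ExpFrac Γ.H1) :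
      Rel (gen Γ x + gen (Γ.flip d) (ratMap (Γ.flipCoh d) x))
  | ihx (Γ : TriGraph) (d : Γ.Dart) (hd : Γ.IsContractible d) (x : ExpFrac Γ.H1) :
      Rel (gen Γ x +
        gen _ (ratMap (TriGraph.resolveCoh hd (Γ.cornerCycle_moves d)) x) +
        gen _ (ratMap (TriGraph.resolveCoh hd (Γ.cornerCycle_sq_moves d)) x))

/-- The space of trivalent graphs decorated by `F(H) = S⁻¹ ℚ[exp(H)]`. -/
abbrev BRat : Type 1 := PreDiag ⧸ Submodule.span ℚ {y | Rel y}

/-- The diagram given by the graph `Γ` with decoration `x`. -/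
def diagram (Γ : TriGraph) : ExpFrac Γ.H1 →ₗ[ℚ] BRat :=
  (Submodule.mkQ _).comp (gen Γ)

open Classical in
/-- Operators on decorations which are compatible with isomorphisms of lattices, combined with
factors which depend only on the number of trivalent vertices, act on the space of diagrams. -/
def diagOp (T : ∀ Γ : TriGraph, ExpFrac Γ.H1 →ₗ[ℚ] ExpFrac Γ.H1)
    (hT : ∀ (Γ Γ' : TriGraph) (e : Γ.H1 ≃+ Γ'.H1), Γ'.numAttached = Γ.numAttached →
      ∀ x, T Γ' (ratMap e x) = ratMap e (T Γ x)) : BRat →ₗ[ℚ] BRat :=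
  Submodule.mapQ _ _
    (DirectSum.toModule ℚ TriGraph PreDiag fun Γ => (gen Γ).comp (T Γ)) <| by
    have hgen : ∀ (Γ : TriGraph) (x : ExpFrac Γ.H1),
        (DirectSum.toModule ℚ TriGraph PreDiag fun Γ => (gen Γ).comp (T Γ)) (gen Γ x)
          = gen Γ (T Γ x) := fun Γ x => DirectSum.toModule_lof (M := fun Γ : TriGraph => ExpFrac Γ.H1)
      (φ := fun Γ => (gen Γ).comp (T Γ)) ℚ Γ x
    refine Submodule.span_le.2 ?_
    rintro y (⟨φ, x⟩ | ⟨Γ, d, hd, x⟩ | ⟨Γ, d, hd, x⟩) <;> apply Submodule.subset_span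
    · simp only [map_sub, hgen]
      rw [hT _ _ _ φ.numAttached_eq.symm]
      exact Rel.iso φ _
    · simp only [map_add, hgen]
      rw [hT _ (Γ.flip d) _ (Γ.numAttached_rewire _ _)]
      exact Rel.orient Γ d hd _
    · simp only [map_add, hgen]
      rw [hT _ _ _ (Γ.numAttached_rewire _ _), hT _ _ _ (Γ.numAttached_rewire _ _)]
      exact Rel.ihx Γ d hd _

theorem diagOp_diagram (T : ∀ Γ : TriGraph, ExpFrac Γ.H1 →ₗ[ℚ] ExpFrac Γ.H1)
    (hT : ∀ (Γ Γ' : TriGraph) (e : Γ.H1 ≃+ Γ'.H1), Γ'.numAttached = Γ.numAttached →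
      ∀ x, T Γ' (ratMap e x) = ratMap e (T Γ x)) (Γ : TriGraph) (x : ExpFrac Γ.H1) :
    diagOp T hT (diagram Γ x) = diagram Γ (T Γ x) := by
  classical
  unfold diagOp diagram
  simp only [LinearMap.comp_apply, Submodule.mkQ_apply, Submodule.mapQ_apply]
  congr 1
  exact DirectSum.toModule_lof (M := fun Γ : TriGraph => ExpFrac Γ.H1)
      (φ := fun Γ => (gen Γ).comp (T Γ)) ℚ Γ x

/-- The operator `lift_r`: it acts on the decorations by `liftRat r`, and the result is multiplied
by `r`. (This is the normalization for connected diagrams.) -/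
def lift (r : ℕ) [NeZero r] : BRat →ₗ[ℚ] BRat :=
  diagOp (fun _ => (r : ℚ) • liftRat r) fun _ _ e _ x => by
    simp only [LinearMap.smul_apply, liftRat_ratMap, map_smul]

theorem lift_diagram (r : ℕ) [NeZero r] (Γ : TriGraph) (x : ExpFrac Γ.H1) :
    lift r (diagram Γ x) = (r : ℚ) • diagram Γ (liftRat r x) := by
  rw [lift, diagOp_diagram, LinearMap.smul_apply, map_smul]

/-- The operator `Π_r`: it multiplies each diagram by `r ^ (-χ)`. -/
def piOp (r : ℕ) : BRat →ₗ[ℚ] BRat :=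
  diagOp (fun Γ => ((r : ℚ) ^ (- Γ.eulerChar)) • LinearMap.id) fun Γ Γ' e h x => by
    have : Γ'.eulerChar = Γ.eulerChar := by simp only [TriGraph.eulerChar, h]
    simp [this]

theorem piOp_diagram (r : ℕ) (Γ : TriGraph) (x : ExpFrac Γ.H1) :
    piOp r (diagram Γ x) = ((r : ℚ) ^ (- Γ.eulerChar)) • diagram Γ x := by
  rw [piOp, diagOp_diagram, LinearMap.smul_apply, map_smul, LinearMap.id_apply]

/-- Series of diagrams: the `N`-th term is the part of loop degree `N`. -/
abbrev BRatSeries : Type 1 := ℕ → BRat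

/-- `lift_r` on series. -/
def liftSeries (r : ℕ) [NeZero r] (Y : BRatSeries) : BRatSeries := fun N => lift r (Y N)

/-- `Π_r` on series. -/
def piSeries (r : ℕ) (Y : BRatSeries) : BRatSeries := fun N => piOp r (Y N)

/-! # Gluing graphs and the series `X_{p,q}` -/

/-- The colours of the vertices: the active colour `*` (power series `f(x)`) and the inert colours
`a, b, c` (power series `f(px)`, `f(qx)`, `f(pqx)`). -/
inductive Colour
  | star
  | a
  | b
  | c
  deriving DecidableEq

instance : Fintype Colour := ⟨{.star, .a, .b, .c}, fun x => by cases x <;> simp⟩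

/-- A finite unoriented graph with coloured vertices; `mult` gives the number of edges between two
vertices. -/
structure GluingGraph where
  V : Type
  [fin : Fintype V]
  col : V → Colour
  mult : Sym2 V → ℕ

attribute [instance] GluingGraph.fin

namespace GluingGraph

variable (G : GluingGraph)

open Classical in
/-- The full subgraph on a set of vertices. -/
def induce (s : Set G.V) : GluingGraph where
  V := s
  col v := G.col v
  mult e := G.mult (e.map (↑))

open Classical in
/-- The valence of a vertex (a loop counts twice). -/
def valence (v : G.V) : ℕ := ∑ w : G.V, G.mult s(v, w) + G.mult s(v, v)

end GluingGraph

/-- A series `∑ a_G · G` over the isomorphism classes of gluing graphs, encoded by its weights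
`φ(G) = |Aut G| · a_G`; equivalently, the series is `∑ n, 1/n! ∑ φ(G) · G`, where the inner sum is
over all gluing graphs with vertex set `{1, …, n}`. (Edges are unlabelled: an automorphism is a
permutation of the vertices which preserves the colours and the multiplicities.) -/
abbrev GSeries : Type 1 := GluingGraph → ℚ

namespace GSeries

open Classical in
/-- The graph with one vertex of colour `x` and no edge. -/
def pt (x : Colour) : GSeries := fun G =>
  if Fintype.card G.V = 1 ∧ (∀ v, G.col v = x) ∧ ∀ e, G.mult e = 0 then 1 else 0

open Classical in
/-- The empty graph. -/
def one : GSeries := fun G => if Fintype.card G.V = 0 then 1 else 0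

open Classical in
/-- The disjoint union product. -/
def mul (φ ψ : GSeries) : GSeries := fun G =>
  ∑ s : Finset G.V,
    if ∀ u ∈ s, ∀ w ∉ s, G.mult s(u, w) = 0 then
      φ (G.induce (s : Set G.V)) * ψ (G.induce (s : Set G.V)ᶜ)
    else 0

/-- Powers for the disjoint union product. -/
def pow (φ : GSeries) : ℕ → GSeries
  | 0 => one
  | k + 1 => mul φ (pow φ k)

/-- The exponential `∑ k, φ ^ k / k!` of a series without constant term; the powers with
`k > |V(G)|` do not contribute to `G`. -/
def exp (φ : GSeries) : GSeries := fun G =>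
  ∑ k ∈ Finset.range (Fintype.card G.V + 1), pow φ k G / (k.factorial : ℚ)

/-- The logarithm `∑ k ≥ 1, (-1) ^ (k + 1) (φ - 1) ^ k / k` of a series with constant term `1`; the
powers with `k > |V(G)|` do not contribute to `G`. -/
def log (φ : GSeries) : GSeries := fun G =>
  ∑ k ∈ Finset.Icc 1 (Fintype.card G.V), (-1 : ℚ) ^ (k + 1) * pow (φ - one) k G / (k : ℚ)

open Classical in
/-- Add, in all ways, a finite number of edges between the `A`-coloured vertices of the first
factor and the `B`-coloured vertices of the second factor. -/
def glue (A B : Set Colour) (φ ψ : GSeries) : GSeries := fun G =>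
  ∑ s : Finset G.V,
    if ∀ u ∈ s, ∀ w ∉ s, G.mult s(u, w) ≠ 0 → G.col u ∈ A ∧ G.col w ∈ B then
      φ (G.induce (s : Set G.V)) * ψ (G.induce (s : Set G.V)ᶜ)
    else 0

/-- The operation `X × Y = log (exp X · exp Y)`. -/
def times (A B : Set Colour) (X Y : GSeries) : GSeries := log (glue A B (exp X) (exp Y))

open Classical in
/-- Divide each graph by `t ^ N`, where `N` is the sum of the valences of the `x`-coloured
vertices. -/
def scale (x : Colour) (t : ℚ) (X : GSeries) : GSeries := fun G =>
  X G / t ^ (∑ v : G.V, if G.col v = x then G.valence v else 0)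

/-- The change of colour `* → c`. -/
def inertColour : Colour → Colour
  | .star => .c
  | x => x

open Classical in
/-- Replace the colour `*` by `c` in each graph. -/
def inert (X : GSeries) : GSeries := fun G =>
  ∑ k : G.V → Colour,
    if ∀ v, inertColour (k v) = G.col v then X { V := G.V, col := k, mult := G.mult } else 0

variable (p q : ℤ)

/-- `X_{pq} = (*^{pq} X)` with `*` replaced by `c`. -/
def toPQ (X : GSeries) : GSeries := inert (scale .star ((p : ℚ) * q) X)

/-- `X^{-1}_{pq} = a^p b^q (•_a × •_b)`. -/
def initial : GSeries := scale .a (p : ℚ) (scale .b (q : ℚ) (times {.a} {.b} (pt .a) (pt .b)))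

/-- The pairs `(X^{n-1}_{pq}, X^n)`, with `X^0 = •_*` and
`X^{n+1} = (X^{n-1}_{pq} - X^n_{pq}) × X^n - (X^{n-1}_{pq} - X^n_{pq})`. -/
def step : ℕ → GSeries × GSeries
  | 0 => (initial p q, pt .star)
  | n + 1 =>
    let P := (step n).1
    let X := (step n).2
    (toPQ p q X, times {.a, .b, .c} {.star} (P - toPQ p q X) X - (P - toPQ p q X))

/-- `X_{p,q} = lim_n (X^{-1}_{pq} - X^n_{pq})`, graph by graph. -/
def xpq : GSeries := fun G =>
  Filter.limUnder Filter.atTop fun n => initial p q G - toPQ p q (step p q n).2 G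

end GSeries

/-! # Bubble trees and the series `Y_{p,q}^rat` -/

section Bubble

variable {N : ℕ} (T : SimpleGraph (Fin N))

/-- Choices for gluing circles at the vertices of a tree: a cyclic ordering of the edges around
each vertex, and an edge at each vertex, used to write down the class of the circle. -/
structure Ribbon where
  next : Equiv.Perm T.Dart
  fst_next : ∀ t, (next t).fst = t.fst
  cyclic : ∀ t t', t.fst = t'.fst → next.SameCycle t t'
  base : Fin N → T.Dart
  fst_base : ∀ v, (base v).fst = v

variable {T}

/-- The choices are possible for each tree with at least two vertices. -/
theorem nonempty_ribbon (hT : T.IsTree) (hN : 2 ≤ N) : Nonempty (Ribbon T) := by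
  classical
  have : Nontrivial (Fin N) := Fin.nontrivial_iff_two_le.2 hN
  have hb : ∀ v : Fin N, ∃ t : T.Dart, t.fst = v := fun v => by
    obtain ⟨w, hw⟩ := hT.connected.preconnected.exists_adj_of_nontrivial v
    exact ⟨⟨(v, w), hw⟩, rfl⟩
  choose b hb using hb
  have hc : ∀ v : Fin N, ∃ f : Equiv.Perm T.Dart,
      f.IsCycleOn (Finset.univ.filter fun t : T.Dart => t.fst = v) := fun v =>
    (Finset.exists_cycleOn _).imp fun _ h => h.1
  choose f hf using hc
  have mem : ∀ (v : Fin N) (t : T.Dart),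
      t ∈ ((Finset.univ.filter fun t : T.Dart => t.fst = v : Finset T.Dart) : Set T.Dart) ↔
        t.fst = v := fun v t => by simp
  have hfst : ∀ t : T.Dart, (f t.fst t).fst = t.fst := fun t =>
    (mem _ _).1 ((hf t.fst).1.mapsTo ((mem _ _).2 rfl))
  have hinj : Function.Injective fun t : T.Dart => f t.fst t := by
    intro t u h
    have h0 : f t.fst t = f u.fst u := h
    have h1 : t.fst = u.fst := by rw [← hfst t, h0, hfst u]
    rw [h1] at h0
    exact (f u.fst).injective h0
  let σ : Equiv.Perm T.Dart := Equiv.ofBijective _ (Finite.injective_iff_bijective.1 hinj)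
  have hσ : ∀ t, σ t = f t.fst t := fun t => rfl
  refine ⟨⟨σ, hfst, fun t t' h => ?_, b, hb⟩⟩
  obtain ⟨n, rfl⟩ := ((hf t.fst).2 ((mem _ _).2 rfl) ((mem _ _).2 h.symm)).exists_nat_pow_eq
  have key : ∀ n : ℕ, (σ ^ n) t = (f t.fst ^ n) t ∧ ((σ ^ n) t).fst = t.fst := by
    intro n
    induction n with
    | zero => simp
    | succ n ih =>
      have h1 : (σ ^ (n + 1)) t = f ((σ ^ n) t).fst ((σ ^ n) t) := by
        rw [pow_succ', Equiv.Perm.mul_apply, hσ]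
      refine ⟨?_, ?_⟩
      · rw [h1, ih.2, ih.1, pow_succ', Equiv.Perm.mul_apply]
      · rw [h1, hfst, ih.2]
  exact ⟨n, by rw [zpow_natCast]; exact (key n).1⟩

variable (β : Ribbon T)

/-- The trivalent graph obtained from the tree `T` by replacing each vertex by a circle, to which
the edges of `T` are attached in the given cyclic order. A vertex is attached to each oriented edge
`t` of `T`: it lies on the circle of `t.fst`, and has the darts `(t, 0)` along the edge `t`,
`(t, 1)` along the circle to the following vertex, `(t, 2)` along the circle to the preceding
vertex. -/
def bubble : TriGraph where
  Dart := T.Dart × Fin 3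
  fin := by
    classical
    infer_instance
  inv
    | (t, 0) => (t.symm, 0)
    | (t, 1) => (β.next t, 2)
    | (t, 2) => (β.next.symm t, 1)
  inv_inv := by
    rintro ⟨t, i⟩
    fin_cases i <;> simp
  inv_ne := by
    rintro ⟨t, i⟩
    fin_cases i <;> simp [SimpleGraph.Dart.symm_ne]
  next := Equiv.prodCongr (Equiv.refl _) (Equiv.addRight 1)
  next_three := by
    rintro ⟨t, i⟩
    fin_cases i <;> simp
  next_inv := by
    rintro ⟨t, i⟩ h
    exfalso
    fin_cases i <;> simp at h

open Classical in
/-- The cochain dual to the arc of a circle which starts at the vertex of `t`. -/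
def arcCochain (t : T.Dart) : (bubble β).cochains :=
  ⟨fun d => match d with
    | (_, 0) => 0
    | (u, 1) => if u = t then 1 else 0
    | (u, 2) => if β.next.symm u = t then -1 else 0, by
    rintro ⟨u, i⟩
    fin_cases i <;> simp [bubble] <;> split_ifs <;> simp⟩

/-- The cohomology class `h_v` of the circle glued at `v`: the class of a small leg attached to
it. -/
def circleClass (v : Fin N) : (bubble β).H1 := (bubble β).cls (arcCochain β (β.base v))

/-- The integers `n_x ∈ {p, q, pq}` attached to the colours (and `1` for `*`). -/
def Colour.value (p q : ℤ) : Colour → ℤ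
  | .star => 1
  | .a => p
  | .b => q
  | .c => p * q

open Classical in
/-- The element `T^rat` obtained from a coloured tree: the bubble tree decorated by
`∏_v κ_v (D ^ (k_v - 1) h_{n_v})(exp(h_v))`, with `k_v` the valence of `v`. -/
def treeRat (p q : ℤ) (κ : Colour → ℚ) (col : Fin N → Colour) : BRat :=
  diagram (bubble β)
    (∏ v : Fin N, κ (col v) •
      evalExp (circleClass β v) (opD^[T.degree v - 1] (hFun ((col v).value p q))))

open Classical in
/-- The gluing graph given by a coloured simple graph. -/
def gluingOf (T : SimpleGraph (Fin N)) (col : Fin N → Colour) : GluingGraph where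
  V := Fin N
  col := col
  mult e := if e ∈ T.edgeSet then 1 else 0

end Bubble

open Classical in
/-- `Y_{p,q}^rat = ∑ T^rat`, the sum over the tree components `T` with at least one edge of
`X_{p,q}`, counted with their coefficients. The part of loop degree `N` is given by the trees with
`N` vertices; the isomorphism classes of trees are summed through all trees on `Fin N`. -/
def yRat (p q : ℤ) (κ : Colour → ℚ)
    (β : ∀ (N : ℕ) (T : SimpleGraph (Fin N)), T.IsTree → 2 ≤ N → Ribbon T) : BRatSeries := fun N =>
  ∑ T : SimpleGraph (Fin N),
    if h : T.IsTree ∧ 2 ≤ N then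
      ∑ col : Fin N → Colour,
        (GSeries.xpq p q (gluingOf T col) / (N.factorial : ℚ)) •
          treeRat (β N T h.1 h.2) p q κ col
    else 0

end TorusLift

end

/-!
The identity holds tree by tree, for every tree `T` with at least one edge; the coefficients of
`X_{p,q}` play no role.

In one variable, a rational function `g` is an eigenfunction of `lift_r` with eigenvalue `c` if
`lift_r g = c g`, which `IsLiftEigen` expresses through polynomials. For `n` prime to `r` the
function `h_n` has eigenvalue `1`: with the denominator `t ^ (r n) - 1` its numerator is a sum
of powers of `t ^ n`, of which only the two extreme ones survive (`isLiftEigen_hFun`).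
Since `D (Q(t ^ r)) = r (D Q)(t ^ r)`, each application of `D` multiplies the eigenvalue by `r`
(`IsLiftEigen.opD`), so `D ^ i h_n` has eigenvalue `r ^ i`.

On the bubble graph of a tree, integration over the circles (`circleEval`) gives functionals on `H¹`
which are dual to the classes `h_v`. Hence a monomial `exp (∑ k_v h_v)` has an exponent divisible by
`r` only if all `k_v` are, and `lift_r` acts separately on the factors of a product of functions of
the `exp (h_v)` (`liftRat_prod_evalExp`). The decoration of `T` is therefore multiplied by
`r ^ ∑ (k_v - 1)`, and the normalization of `lift_r` contributes one more factor `r`. For a tree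
with `N` vertices `∑ k_v = 2 (N - 1)`, so the total exponent is `N - 1`, which is minus the Euler
characteristic of the bubble graph (`eulerChar_bubble`); this is the factor in `Π_r`.
-/

noncomputable section

namespace TorusLift

open Polynomial

/-! ### Rational functions as fractions of polynomials -/

theorem num_mul_eq_of_fraction {g : RatFunc ℚ} {A B : ℚ[X]}
    (hg : g * algebraMap ℚ[X] (RatFunc ℚ) B = algebraMap ℚ[X] (RatFunc ℚ) A) :
    g.num * B = A * g.denom := by
  have hd : algebraMap ℚ[X] (RatFunc ℚ) g.denom ≠ 0 := RatFunc.algebraMap_ne_zero g.denom_ne_zero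
  have hn : algebraMap ℚ[X] (RatFunc ℚ) g.num = g * algebraMap ℚ[X] (RatFunc ℚ) g.denom :=
    (div_eq_iff hd).1 g.num_div_denom
  apply IsFractionRing.injective ℚ[X] (RatFunc ℚ)
  rw [map_mul, map_mul, ← hg, hn]
  ring

/-- Evaluation at `exp(h)` may be computed from any fraction `A / B` representing `g`. -/
theorem evalExp_mul_of_fraction {H : Type} [AddCommGroup H] [IsAddTorsionFree H] {h : H}
    (hh : h ≠ 0) {g : RatFunc ℚ} {A B : ℚ[X]}
    (hg : g * algebraMap ℚ[X] (RatFunc ℚ) B = algebraMap ℚ[X] (RatFunc ℚ) A) :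
    evalExp h g * toRat (aeval (expo h) B) = toRat (aeval (expo h) A) := by
  have hu : IsUnit (toRat (aeval (expo h) g.denom)) :=
    IsLocalization.map_units (ExpFrac H) (⟨_, Submonoid.subset_closure
      ⟨aeval_expo_ne_zero h hh _ g.denom_ne_zero, g.denom, h, rfl⟩⟩ : denoms H)
  have h2 : toRat (aeval (expo h) g.num) * toRat (aeval (expo h) B) =
      toRat (aeval (expo h) A) * toRat (aeval (expo h) g.denom) := by
    simp only [toRat, ← map_mul, num_mul_eq_of_fraction hg]
  apply hu.mul_right_cancel
  rw [evalExp, ← h2]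
  linear_combination toRat (aeval (expo h) g.num) * toRat (aeval (expo h) B) *
    Ring.inverse_mul_cancel _ hu

/-- The quotient rule, for an arbitrary fraction `A / B` representing `g`. -/
theorem opD_mul_sq_of_fraction {g : RatFunc ℚ} {A B : ℚ[X]}
    (hg : g * algebraMap ℚ[X] (RatFunc ℚ) B = algebraMap ℚ[X] (RatFunc ℚ) A) :
    opD g * algebraMap ℚ[X] (RatFunc ℚ) (B ^ 2) =
      algebraMap ℚ[X] (RatFunc ℚ) (X * (derivative A * B - A * derivative B)) := by
  have hd : algebraMap ℚ[X] (RatFunc ℚ) g.denom ≠ 0 := RatFunc.algebraMap_ne_zero g.denom_ne_zero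
  have hpoly := num_mul_eq_of_fraction hg
  have hder := congrArg derivative hpoly
  rw [derivative_mul, derivative_mul] at hder
  have key : (derivative g.num * g.denom - g.num * derivative g.denom) * B ^ 2 =
      (derivative A * B - A * derivative B) * g.denom ^ 2 := by
    linear_combination g.denom * B * hder -
      (derivative g.denom * B + g.denom * derivative B) * hpoly
  have key' := congrArg (algebraMap ℚ[X] (RatFunc ℚ)) key
  rw [opD, ratDeriv, map_mul _ X, RatFunc.algebraMap_X]
  rw [map_mul, map_mul, map_pow _ g.denom] at key'
  rw [mul_assoc, div_mul_eq_mul_div, key', mul_div_cancel_right₀ _ (pow_ne_zero 2 hd)]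

/-! ### Eigenfunctions of the lift in one variable -/

section OneVar

variable (r : ℕ)

/-- The rational function `g` is an eigenfunction of the lift with eigenvalue `c`. This is encoded
by polynomials: `g = A(t) / Q(t ^ r) = B(t) / Q(t)`, and the part of `A` with exponents divisible
by `r` is `c B(t ^ r)`. -/
def IsLiftEigen (c : ℚ) (g : RatFunc ℚ) : Prop :=
  ∃ A B Q : ℚ[X], Q ≠ 0 ∧
    g * algebraMap ℚ[X] (RatFunc ℚ) (expand ℚ r Q) = algebraMap ℚ[X] (RatFunc ℚ) A ∧
    g * algebraMap ℚ[X] (RatFunc ℚ) Q = algebraMap ℚ[X] (RatFunc ℚ) B ∧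
    contract r A = C c * B

variable [NeZero r]

/-- `Polynomial.contract` as a linear map. -/
def contractLin : ℚ[X] →ₗ[ℚ] ℚ[X] where
  toFun := contract r
  map_add' := contract_add (NeZero.ne r)
  map_smul' c f := by ext n; simp [coeff_contract (NeZero.ne r)]

variable {r}

theorem contract_X_pow_mul (i : ℕ) : contract r (X ^ (r * i) : ℚ[X]) = X ^ i := by
  rw [pow_mul, ← expand_X, ← map_pow]
  exact contract_expand r (NeZero.ne r)

theorem contract_X_pow_of_not_dvd {i : ℕ} (hi : ¬ r ∣ i) : contract r (X ^ i : ℚ[X]) = 0 := by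
  ext n
  rw [coeff_contract (NeZero.ne r), coeff_X_pow, if_neg, coeff_zero]
  rintro rfl
  exact hi (dvd_mul_left r n)

theorem contract_X_mul_derivative (A : ℚ[X]) :
    contract r (X * derivative A) = (r : ℚ[X]) * (X * derivative (contract r A)) := by
  have hX : ∀ (B : ℚ[X]) (n : ℕ), (X * derivative B).coeff n = n * B.coeff n := by
    rintro B (_ | n)
    · simp
    · rw [coeff_X_mul, coeff_derivative]; push_cast; ring
  ext n
  rw [coeff_contract (NeZero.ne r), hX, coeff_natCast_mul, hX, coeff_contract (NeZero.ne r)]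
  push_cast; ring

theorem X_mul_derivative_expand (Q : ℚ[X]) :
    X * derivative (expand ℚ r Q) = expand ℚ r ((r : ℚ[X]) * (X * derivative Q)) := by
  obtain ⟨k, hk⟩ := Nat.exists_eq_succ_of_ne_zero (NeZero.ne r)
  rw [derivative_expand, map_mul, map_mul, expand_X, map_natCast, hk, Nat.succ_eq_add_one,
    Nat.add_sub_cancel]
  ring

/-- The operator `D = t d/dt` multiplies the eigenvalue by `r`, because
`D (Q(t ^ r)) = r (D Q)(t ^ r)`. -/
theorem IsLiftEigen.opD {c : ℚ} {g : RatFunc ℚ} (h : IsLiftEigen r c g) :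
    IsLiftEigen r (r * c) (opD g) := by
  obtain ⟨A, B, Q, hQ, h1, h2, h3⟩ := h
  have hr := NeZero.ne r
  have hA := opD_mul_sq_of_fraction h1
  rw [← map_pow (expand ℚ r)] at hA
  refine ⟨_, _, Q ^ 2, pow_ne_zero 2 hQ, hA, opD_mul_sq_of_fraction h2, ?_⟩
  have e : X * (derivative A * expand ℚ r Q - A * derivative (expand ℚ r Q)) =
      (X * derivative A) * expand ℚ r Q - A * expand ℚ r ((r : ℚ[X]) * (X * derivative Q)) := by
    rw [← X_mul_derivative_expand]; ring
  have hsub : ∀ P R : ℚ[X], contract r (P - R) = contract r P - contract r R :=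
    (contractLin r).map_sub
  rw [e, hsub, contract_mul_expand hr, contract_mul_expand hr, contract_X_mul_derivative, h3,
    derivative_C_mul, C_mul, map_natCast]
  ring

theorem IsLiftEigen.iterate_opD {c : ℚ} {g : RatFunc ℚ} (h : IsLiftEigen r c g) (i : ℕ) :
    IsLiftEigen r (r ^ i * c) (TorusLift.opD^[i] g) := by
  induction i with
  | zero => simpa using h
  | succ i ih =>
    rw [Function.iterate_succ_apply', pow_succ', mul_assoc]
    exact ih.opD

/-- The geometric sum `t ^ (r n) - 1 = (t ^ n - 1) (1 + t ^ n + ⋯ + t ^ (n (r - 1)))` gives a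
denominator in `t ^ r`; the numerator is then a sum of powers of `t ^ n`, of which only the extreme
ones have an exponent divisible by `r`. -/
theorem isLiftEigen_hFun_natCast {n : ℕ} (hn : n ≠ 0) (hrn : Nat.Coprime r n) :
    IsLiftEigen r 1 (hFun n) := by
  have hr := NeZero.ne r
  have hQ : (X ^ n - 1 : ℚ[X]) ≠ 0 := X_pow_sub_C_ne_zero (Nat.pos_of_ne_zero hn) 1
  have hQ' : (RatFunc.X ^ n - 1 : RatFunc ℚ) ≠ 0 := by
    have := RatFunc.algebraMap_ne_zero hQ
    simpa only [map_sub, map_pow, RatFunc.algebraMap_X, map_one] using this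
  have hh : hFun n * algebraMap ℚ[X] (RatFunc ℚ) (X ^ n - 1) =
      algebraMap ℚ[X] (RatFunc ℚ) (X ^ n + 1) := by
    simp only [hFun, zpow_natCast, map_sub, map_add, map_pow, RatFunc.algebraMap_X, map_one]
    exact div_mul_cancel₀ _ hQ'
  refine ⟨(X ^ n + 1) * ∑ j ∈ Finset.range r, (X ^ n) ^ j, X ^ n + 1, X ^ n - 1, hQ, ?_, hh, ?_⟩
  · have e : expand ℚ r (X ^ n - 1) = (X ^ n - 1) * ∑ j ∈ Finset.range r, (X ^ n : ℚ[X]) ^ j := by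
      rw [mul_geom_sum, map_sub, map_pow, expand_X, map_one, ← pow_mul, ← pow_mul, mul_comm]
    rw [e, map_mul, ← mul_assoc, hh, ← map_mul]
  · have hndvd : ∀ j ∈ Finset.Ico 1 r, ¬ r ∣ n * j := by
      intro j hj hd
      have := Nat.le_of_dvd (by have := (Finset.mem_Ico.1 hj).1; omega) (hrn.dvd_of_dvd_mul_left hd)
      exact absurd (Finset.mem_Ico.1 hj).2 (by omega)
    have hmid : contract r (∑ j ∈ Finset.Ico 1 r, (X ^ n : ℚ[X]) ^ j) = 0 := by
      change contractLin r _ = 0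
      rw [map_sum]
      refine Finset.sum_eq_zero fun j hj => ?_
      rw [← pow_mul]
      exact contract_X_pow_of_not_dvd (hndvd j hj)
    have e : (X ^ n + 1) * ∑ j ∈ Finset.range r, (X ^ n : ℚ[X]) ^ j =
        X ^ (r * n) + (2 : ℚ) • (∑ j ∈ Finset.Ico 1 r, (X ^ n : ℚ[X]) ^ j) + X ^ (r * 0) := by
      have h1 : ∑ j ∈ Finset.range r, (X ^ n : ℚ[X]) ^ j =
          1 + ∑ j ∈ Finset.Ico 1 r, (X ^ n : ℚ[X]) ^ j := by
        rw [Finset.range_eq_Ico, Finset.sum_eq_sum_Ico_succ_bot (NeZero.pos r), pow_zero]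
      have h2 := mul_geom_sum (X ^ n : ℚ[X]) r
      rw [ofNat_smul_eq_nsmul, mul_comm r n, pow_mul]
      linear_combination h2 + 2 * h1
    change contractLin r _ = _
    rw [e, map_add, map_add, map_smul]
    change contract r _ + _ • contract r _ + contract r _ = _
    rw [hmid, contract_X_pow_mul, contract_X_pow_mul]
    simp

theorem IsLiftEigen.neg {c : ℚ} {g : RatFunc ℚ} (h : IsLiftEigen r c g) :
    IsLiftEigen r c (-g) := by
  obtain ⟨A, B, Q, hQ, h1, h2, h3⟩ := h
  refine ⟨-A, -B, Q, hQ, ?_, ?_, ?_⟩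
  · rw [neg_mul, h1, map_neg]
  · rw [neg_mul, h2, map_neg]
  · rw [mul_neg, ← h3]
    exact (contractLin r).map_neg A

theorem isLiftEigen_hFun {n : ℤ} (hn : n ≠ 0) (hrn : IsCoprime (r : ℤ) n) :
    IsLiftEigen r 1 (hFun n) := by
  have hpos : IsLiftEigen r 1 (hFun (n.natAbs : ℤ)) :=
    isLiftEigen_hFun_natCast (Int.natAbs_ne_zero.2 hn) (Int.isCoprime_iff_gcd_eq_one.1 hrn)
  rcases Int.natAbs_eq n with h | h
  · rwa [h]
  · have e : hFun n = - hFun (n.natAbs : ℤ) := by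
      rw [h]
      simp only [hFun, Int.natAbs_neg, Int.natAbs_natCast, zpow_neg]
      have hX : (RatFunc.X ^ (n.natAbs : ℤ) : RatFunc ℚ) ≠ 0 := zpow_ne_zero _ RatFunc.X_ne_zero
      generalize (RatFunc.X ^ (n.natAbs : ℤ) : RatFunc ℚ) = y at hX
      have e1 : y⁻¹ + 1 = (y + 1) * y⁻¹ := by field_simp; ring
      have e2 : y⁻¹ - 1 = -(y - 1) * y⁻¹ := by field_simp; ring
      rw [e1, e2, mul_div_mul_right _ _ (inv_ne_zero hX), div_neg]
    rw [e]
    exact hpos.neg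

end OneVar

/-! ### The lift of a product of functions in independent variables -/

section Product

variable {ι H : Type} [Fintype ι] [AddCommGroup H] {h : ι → H} {f : ι → H →+ ℤ} (r : ℕ)

theorem prod_expo_pow (k : ι → ℕ) : ∏ v, expo (h v) ^ k v = expo (∑ v, k v • h v) := by
  classical
  have hp : ∀ v, expo (h v) ^ k v = expo (k v • h v) := fun v => by
    simp [expo, AddMonoidAlgebra.single_pow]
  simp only [hp]
  induction (Finset.univ : Finset ι) using Finset.induction_on with
  | empty => simp [expo, AddMonoidAlgebra.one_def]
  | insert a s ha ih =>
    rw [Finset.prod_insert ha, Finset.sum_insert ha, ih]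
    simp [expo]

variable [IsAddTorsionFree H] [NeZero r]

/-- If the classes `h v` have dual functionals, a monomial in the `exp (h v)` has an exponent
divisible by `r` if and only if this holds for the exponent of each variable. -/
theorem keep_prod_aeval_expo [DecidableEq ι]
    (hf : ∀ v w, f w (h v) = if v = w then 1 else 0) (A : ι → ℚ[X]) :
    keep r (∏ v, aeval (expo (h v)) (A v)) = ∏ v, aeval (expo (h v)) (contract r (A v)) := by
  have hml : (keep r).compMultilinearMap ((MultilinearMap.mkPiAlgebra ℚ ι (ExpAlg H)).compLinearMap
        fun v => (aeval (expo (h v))).toLinearMap) =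
      (MultilinearMap.mkPiAlgebra ℚ ι (ExpAlg H)).compLinearMap
        fun v => (aeval (expo (h v))).toLinearMap.comp (contractLin r) := by
    refine Module.Basis.ext_multilinear (fun _ => Polynomial.basisMonomials ℚ) fun k => ?_
    simp only [LinearMap.compMultilinearMap_apply, MultilinearMap.compLinearMap_apply,
      MultilinearMap.mkPiAlgebra_apply, coe_basisMonomials, AlgHom.toLinearMap_apply,
      LinearMap.comp_apply, monomial_one_right_eq_X_pow, map_pow, aeval_X, prod_expo_pow]
    change _ = ∏ v, aeval (expo (h v)) (contract r (X ^ k v))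
    by_cases hk : ∀ v, r ∣ k v
    · choose m hm using hk
      simp only [hm, contract_X_pow_mul, map_pow, aeval_X, prod_expo_pow, mul_smul,
        ← Finset.smul_sum, keep_expo_smul]
    · push Not at hk
      obtain ⟨w, hw⟩ := hk
      rw [Finset.prod_eq_zero (Finset.mem_univ w) (by rw [contract_X_pow_of_not_dvd hw, map_zero])]
      refine keep_expo_of_not_dvd r _ fun ν hν => hw ?_
      have h1 := congrArg (f w) hν
      simp only [map_nsmul, map_sum, hf, nsmul_eq_mul, mul_ite, mul_one, mul_zero,
        Finset.sum_ite_eq', Finset.mem_univ, if_true] at h1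
      exact Int.natCast_dvd_natCast.1 ⟨_, h1.symm⟩
  exact congrArg (fun F => F A) hml

variable [AddMonoid.FG H]

theorem liftRat_prod_evalExp [DecidableEq ι]
    (hf : ∀ v w, f w (h v) = if v = w then 1 else 0)
    {c : ι → ℚ} {g : ι → RatFunc ℚ} (hg : ∀ v, IsLiftEigen r (c v) (g v)) :
    liftRat r (∏ v, evalExp (h v) (g v)) = (∏ v, c v) • ∏ v, evalExp (h v) (g v) := by
  have hh : ∀ v, h v ≠ 0 := fun v h0 => by simpa [h0] using hf v v
  choose A B Q hQ h1 h2 h3 using hg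
  let q : denoms H := ⟨∏ v, aeval (expo (h v)) (Q v), prod_mem fun v _ =>
    Submonoid.subset_closure ⟨aeval_expo_ne_zero (h v) (hh v) _ (hQ v), Q v, h v, rfl⟩⟩
  have hfrob : ∀ v, frob r (aeval (expo (h v)) (Q v)) = aeval (expo (h v)) (expand ℚ r (Q v)) :=
    fun v => by
      rw [← Polynomial.aeval_algHom_apply, frob_expo, Polynomial.expand_aeval]
      congr 1
      simp [expo, AddMonoidAlgebra.single_pow]
  have hx : (∏ v, evalExp (h v) (g v)) * toRat (frob r q) =
      toRat (∏ v, aeval (expo (h v)) (A v)) := by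
    simp only [q, toRat, map_prod, hfrob, ← Finset.prod_mul_distrib]
    exact Finset.prod_congr rfl fun v _ => evalExp_mul_of_fraction (hh v) (h1 v)
  have hy : (∏ v, evalExp (h v) (g v)) * toRat q = toRat (∏ v, aeval (expo (h v)) (B v)) := by
    simp only [q, toRat, map_prod, ← Finset.prod_mul_distrib]
    exact Finset.prod_congr rfl fun v _ => evalExp_mul_of_fraction (hh v) (h2 v)
  have hs : ∀ (c : ℚ) (a : ExpAlg H), toRat (c • a) = c • toRat a := fun c a =>
    (IsScalarTower.toAlgHom ℚ (ExpAlg H) (ExpFrac H)).map_smul_of_tower c a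
  rw [liftRat_mk' r _ q _ hx, keep_prod_aeval_expo r hf, IsLocalization.mk'_eq_iff_eq_mul,
    smul_mul_assoc, hy]
  simp only [h3, map_mul, aeval_C, ← Algebra.smul_def]
  rw [Finset.prod_smul]
  exact hs _ _

end Product

/-! ### The bubble graph of a tree -/

section BubbleGraph

variable {N : ℕ} {T : SimpleGraph (Fin N)} (β : Ribbon T)

open Classical in
/-- The value of a cohomology class on the fundamental cycle of the circle at `w`: the sum of a
cochain over the arcs of the circle. -/
def circleEval (w : Fin N) : (bubble β).H1 →+ ℤ :=
  QuotientAddGroup.lift (bubble β).coboundaries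
    { toFun := fun c => ∑ t : T.Dart, if t.fst = w then c.1 (t, 1) else 0
      map_zero' := Finset.sum_eq_zero fun t _ => ite_self _
      map_add' := fun a b => by
        rw [← Finset.sum_add_distrib]
        refine Finset.sum_congr rfl fun t _ => ?_
        split_ifs
        · rfl
        · rw [add_zero] }
    (by
      rintro c ⟨g, hg, hgc⟩
      have h1 : ∀ (t : T.Dart) (i : Fin 3), g (t, i) = g (t, 0) := fun t i => by
        have e1 : g (t, 1) = g (t, 0) := hg.1 (t, 0)
        have e2 : g (t, 2) = g (t, 1) := hg.1 (t, 1)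
        fin_cases i
        · rfl
        · exact e1
        · exact e2.trans e1
      have h2 : ∀ t : T.Dart, (if t.fst = w then c.1 (t, 1) else 0) =
          (if (β.next t).fst = w then g (β.next t, 0) else 0) -
            if t.fst = w then g (t, 0) else 0 := fun t => by
        have h3 : c.1 (t, 1) = g (β.next t, 2) - g (t, 1) := hgc (t, 1)
        rw [β.fst_next, h3, h1 _ 2, h1 _ 1]
        split_ifs <;> simp
      change ∑ t : T.Dart, (if t.fst = w then c.1 (t, 1) else 0) = 0
      -- The sum telescopes along the circle.
      rw [Finset.sum_congr rfl fun t _ => h2 t, Finset.sum_sub_distrib,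
        Equiv.sum_comp β.next fun t => if t.fst = w then g (t, 0) else 0, sub_self])

theorem circleEval_circleClass (v w : Fin N) :
    circleEval β w (circleClass β v) = if v = w then 1 else 0 := by
  classical
  change ∑ t : T.Dart, (if t.fst = w then (if t = β.base v then (1 : ℤ) else 0) else 0) = _
  rw [Finset.sum_eq_single (β.base v)]
  · simp [β.fst_base]
  · intro t _ ht
    simp [ht]
  · simp

theorem numAttached_bubble : (bubble β).numAttached = Nat.card T.Dart * 3 := by
  have h : ∀ d : (bubble β).Dart, (bubble β).next d ≠ d := by
    rintro ⟨t, i⟩ h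
    have : i + 1 = i := congrArg Prod.snd h
    fin_cases i <;> simp at this
  rw [TriGraph.numAttached, Nat.card_congr (Equiv.subtypeUnivEquiv h)]
  change Nat.card (T.Dart × Fin 3) = _
  rw [Nat.card_prod, Nat.card_fin]

open Classical in
theorem card_dart_of_isTree (hT : T.IsTree) : Nat.card T.Dart + 2 = 2 * N := by
  have h := hT.card_edgeFinset
  rw [Fintype.card_fin] at h
  rw [Nat.card_eq_fintype_card, T.dart_card_eq_twice_card_edges]
  omega

theorem eulerChar_bubble (hT : T.IsTree) : (bubble β).eulerChar = 1 - N := by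
  have h := card_dart_of_isTree hT
  rw [TriGraph.eulerChar, numAttached_bubble]
  omega

open Classical in
theorem sum_degree_sub_one (hT : T.IsTree) (hN : 2 ≤ N) : ∑ v, (T.degree v - 1) + 2 = N := by
  have : Nontrivial (Fin N) := Fin.nontrivial_iff_two_le.2 hN
  have h := T.sum_degrees_eq_twice_card_edges
  rw [← T.dart_card_eq_twice_card_edges, ← Nat.card_eq_fintype_card] at h
  have h1 : ∑ v, (T.degree v - 1) + ∑ _v : Fin N, 1 = ∑ v, T.degree v := by
    rw [← Finset.sum_add_distrib]
    refine Finset.sum_congr rfl fun v _ => Nat.sub_add_cancel ?_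
    exact hT.connected.preconnected.degree_pos_of_nontrivial v
  have h2 := card_dart_of_isTree hT
  rw [Finset.sum_const, Finset.card_univ, Fintype.card_fin, smul_eq_mul, mul_one] at h1
  omega

/-- The exponents of `r` on both sides agree: a tree with `N` vertices of valences `k v` has
`1 + ∑ v, (k v - 1) = N - 1`, and this is minus the Euler characteristic of its bubble graph. -/
theorem lift_treeRat (hT : T.IsTree) (hN : 2 ≤ N) (r : ℕ) [NeZero r] (p q : ℤ)
    (κ : Colour → ℚ) (col : Fin N → Colour)
    (hcol : ∀ x : Colour, x.value p q ≠ 0 ∧ IsCoprime (r : ℤ) (x.value p q)) :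
    lift r (treeRat β p q κ col) = piOp r (treeRat β p q κ col) := by
  classical
  have hprod := liftRat_prod_evalExp r (circleEval_circleClass β)
    fun v : Fin N => (isLiftEigen_hFun (hcol (col v)).1 (hcol (col v)).2).iterate_opD
      (T.degree v - 1)
  simp only [mul_one] at hprod
  rw [Finset.prod_pow_eq_pow_sum] at hprod
  have hexp : (r : ℚ) * (r : ℚ) ^ (∑ v, (T.degree v - 1)) = (r : ℚ) ^ (-(bubble β).eulerChar) := by
    have e : -(bubble β).eulerChar = ((∑ v, (T.degree v - 1) + 1 : ℕ) : ℤ) := by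
      rw [eulerChar_bubble β hT]
      have := sum_degree_sub_one hT hN
      omega
    rw [e, zpow_natCast, pow_succ']
  rw [treeRat, lift_diagram, piOp_diagram, Finset.prod_smul, map_smul, hprod, ← hexp]
  simp only [map_smul, smul_smul]
  congr 1
  ring

end BubbleGraph

end TorusLift

end

theorem mainTheorem2 (p q : ℤ) (hp : 0 < p) (hq : q ≠ 0) (hpq : IsCoprime p q)
    (r : ℕ) [NeZero r] (hrp : IsCoprime (r : ℤ) p) (hrq : IsCoprime (r : ℤ) q)
    (κ : TorusLift.Colour → ℚ)
    (β : ∀ (N : ℕ) (T : SimpleGraph (Fin N)), T.IsTree → 2 ≤ N → TorusLift.Ribbon T) :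
    TorusLift.liftSeries r (TorusLift.yRat p q κ β) =
        TorusLift.piSeries r (TorusLift.yRat p q κ β) ∧
      ∀ n : ℤ, n ≠ 0 → IsCoprime (r : ℤ) n → ∀ i : ℕ,
        TorusLift.liftRat r
            (TorusLift.evalExp (1 : ℤ) (TorusLift.opD^[i] (TorusLift.hFun n))) =
          ((r : ℚ) ^ i) • TorusLift.evalExp (1 : ℤ) (TorusLift.opD^[i] (TorusLift.hFun n)) := by
  classical
  refine ⟨funext fun N => ?_, fun n hn hrn i => ?_⟩
  · have hcol : ∀ x : TorusLift.Colour,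
        x.value p q ≠ 0 ∧ IsCoprime (r : ℤ) (x.value p q) := by
      rintro (_ | _ | _ | _)
      · exact ⟨one_ne_zero, isCoprime_one_right⟩
      · exact ⟨hp.ne', hrp⟩
      · exact ⟨hq, hrq⟩
      · exact ⟨mul_ne_zero hp.ne' hq, hrp.mul_right hrq⟩
    simp only [TorusLift.liftSeries, TorusLift.piSeries, TorusLift.yRat, map_sum]
    refine Finset.sum_congr rfl fun T _ => ?_
    split_ifs with h
    · simp only [map_sum, map_smul]
      exact Finset.sum_congr rfl fun col _ => congrArg _
        (TorusLift.lift_treeRat _ h.1 h.2 r p q κ col hcol)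
    · simp only [map_zero]
  · have h := TorusLift.liftRat_prod_evalExp (ι := Unit) (h := fun _ => (1 : ℤ))
      (f := fun _ => AddMonoidHom.id ℤ) r (fun _ _ => by simp)
      (fun _ => (TorusLift.isLiftEigen_hFun hn hrn).iterate_opD i)
    simpa using h
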